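/- **Theorem 3.1 (Variational structure).** Let $\mathcal S^N$, $\mathcal S^N_{+}$, $\mathcal S^N_{++}$ be the sets of symmetric, symmetric positive semidefinite and symmetric positive definite real $N\times N$ matrices. For a measurable $U:\mathbb R^N\to\mathbb R$ and $A\in\mathcal S^N$ put $$Z[A]=\int_{\mathbb R^N}e^{-\frac12x^TAx-U(x)}\,dx\in(0,\infty],\qquad \Omega[A]=-\log Z[A]\in\mathbb R\cup\{-\infty\},\qquad \mathrm{dom}\,\Omega=\{A\in\mathcal S^N:\Omega[A]>-\infty\}.$$ Suppose that $U$ satisfies the weak growth condition: there is a constant $C_U$ with $U(x)+C_U(1+\|x\|^2)\ge 0$ for all $x\in\mathbb R^N$, and $\mathrm{dom}\,\Omega$ is open in $\mathcal S^N$. For $G\in\mathcal S^N$ let $\mathcal G^{-1}(G)$ be the set of Borel probability measures $\mu$ on $\mathbb R^N$ with finite second moments and $\int xx^T\,d\mu=G$. Let $H(\mu)=-\int\log\frac{d\mu}{dx}\,d\mu$ if $\mu$ is absolutely continuous with respect to Lebesgue measure, and $H(\mu)=-\infty$ otherwise, and define $$\mathcal F[G]=\sup_{\mu\in\mathcal G^{-1}(G)}\Big[H(\mu)-\int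 U\,d\mu\Big]\in[-\infty,\infty],\qquad \sup\emptyset=-\infty .$$ For $f:\mathcal S^N\to\mathbb R$ differentiable at $A$ let $\nabla f(A)\in\mathcal S^N$ be the matrix with entries $\nabla_{ij}f(A)=\lim_{\delta\to0}\delta^{-1}\big(f(A+\delta E^{(ij)})-f(A)\big)$, where $E^{(ij)}_{kl}=\delta_{ik}\delta_{jl}+\delta_{il}\delta_{jk}$; this is the gradient with respect to the inner product $\langle A,G\rangle=\frac12\mathrm{Tr}[AG]$. Then: 1. For every $A\in\mathcal S^N$, $$\Omega[A]=\inf_{G\in\mathcal S^N_{+}}\Big(\tfrac12\mathrm{Tr}[AG]-\mathcal F[G]\Big).$$ 2. $\mathcal F$ is the concave conjugate of $\Omega$ with respect to $\langle\cdot,\cdot\rangle$: for every $G\in\mathcal S^N$, $\mathcal F[G]=\inf_{A\in\mathcal S^N}\big(\frac12\mathrm{Tr}[AG]-\Omega[A]\big)$. 3. $\mathcal G^{-1}(G)$ is empty if and only if $G\in\mathcal S^N\setminus\mathcal S^N_{+}$. Neither $\Omega$ nor $\mathcal F$ takes the value $+\infty$, and $\mathrm{dom}\,\mathcal F=\{G\in\mathcal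 S^N:\mathcal F[G]>-\infty\}=\mathcal S^N_{++}$. 4. $\Omega$ is $C^\infty$ and strictly concave on $\mathrm{dom}\,\Omega$, and $\mathcal F$ is $C^\infty$ and strictly concave on $\mathcal S^N_{++}$. 5. $\nabla\Omega$ is a bijection from $\mathrm{dom}\,\Omega$ onto $\mathcal S^N_{++}$, with inverse $\nabla\mathcal F$. -/

import Mathlib

open MeasureTheory
open scoped ENNReal Matrix ContDiff

attribute [local instance] Matrix.normedAddCommGroup Matrix.normedSpace

namespace LuttingerWard

/-- The real vector space `S^N` of symmetric real `N × N` matrices. It is given the norm and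
topology induced from matrix entries; since it is finite dimensional, openness and smoothness do not
depend on the choice of the norm. -/
def SymMat (N : ℕ) : Submodule ℝ (Matrix (Fin N) (Fin N) ℝ) where
  carrier := {A | A.IsSymm}
  add_mem' := fun ha hb => Matrix.IsSymm.add ha hb
  zero_mem' := Matrix.isSymm_zero
  smul_mem' := fun c _ ha => Matrix.IsSymm.smul ha c

/-- The set `S^N_{+}` of symmetric positive semidefinite matrices. -/
def posSemidefCone (N : ℕ) : Set (SymMat N) := {G | (G : Matrix (Fin N) (Fin N) ℝ).PosSemidef}

/-- The set `S^N_{++}` of symmetric positive definite matrices. -/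
def posDefCone (N : ℕ) : Set (SymMat N) := {G | (G : Matrix (Fin N) (Fin N) ℝ).PosDef}

/-- The quadratic form `xᵀ A x`. -/
def quadForm {N : ℕ} (A : SymMat N) (x : EuclideanSpace ℝ (Fin N)) : ℝ :=
  x.ofLp ⬝ᵥ ((A : Matrix (Fin N) (Fin N) ℝ) *ᵥ x.ofLp)

/-- The inner product `⟨A, G⟩ = ½ Tr[A G]` on symmetric matrices. -/
noncomputable def halfTrace {N : ℕ} (A G : SymMat N) : ℝ :=
  (1 / 2) * ((A : Matrix (Fin N) (Fin N) ℝ) * (G : Matrix (Fin N) (Fin N) ℝ)).trace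

/-- The partition function `Z[A] = ∫ exp(-½ xᵀ A x - U(x)) dx ∈ [0, ∞]`. -/
noncomputable def partitionFn {N : ℕ} (U : EuclideanSpace ℝ (Fin N) → ℝ) (A : SymMat N) : ℝ≥0∞ :=
  ∫⁻ x, ENNReal.ofReal (Real.exp (-(1 / 2) * quadForm A x - U x))

/-- The free energy `Ω[A] = -log Z[A]`, equal to `-∞` where the integral diverges. -/
noncomputable def freeEnergy {N : ℕ} (U : EuclideanSpace ℝ (Fin N) → ℝ) (A : SymMat N) : EReal :=
  -ENNReal.log (partitionFn U A)

/-- The effective domain `{X | f X > -∞}` of an extended-real-valued (concave) function. -/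
def effDom {N : ℕ} (f : SymMat N → EReal) : Set (SymMat N) := {X | ⊥ < f X}

/-- The weak growth condition: `U` is measurable, does not decay to `-∞` faster than quadratically,
and `dom Ω` is open in `S^N`. -/
structure WeakGrowth {N : ℕ} (U : EuclideanSpace ℝ (Fin N) → ℝ) : Prop where
  measurable : Measurable U
  bound : ∃ C : ℝ, ∀ x, 0 ≤ U x + C * (1 + ‖x‖ ^ 2)
  isOpen_dom : IsOpen (effDom (freeEnergy U))

/-- The extended-real-valued Lebesgue integral `∫ f⁺ dμ - ∫ f⁻ dμ`, meaningful as soon as one of the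
two terms is finite. -/
noncomputable def extIntegral {E : Type*} [MeasurableSpace E] (μ : Measure E) (f : E → ℝ) : EReal :=
  ((∫⁻ x, ENNReal.ofReal (f x) ∂μ : ℝ≥0∞) : EReal) -
    ((∫⁻ x, ENNReal.ofReal (-f x) ∂μ : ℝ≥0∞) : EReal)

open Classical in
/-- The differential entropy `H(μ) = -∫ log (dμ/dλ) dμ` if `μ ≪ λ`, and `-∞` otherwise, where `λ` is
Lebesgue measure. For measures with second moments the negative part of `log (dμ/dλ)` has
finite integral, so that the integral exists in `(-∞, ∞]`. -/
noncomputable def entropy {N : ℕ} (μ : Measure (EuclideanSpace ℝ (Fin N))) : EReal :=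
  if μ ≪ volume then -extIntegral μ (fun x => Real.log (μ.rnDeriv volume x).toReal) else ⊥

/-- The fiber `𝒢⁻¹(G)`: Borel probability measures on `ℝ^N` with finite second moments and
`∫ x xᵀ dμ = G`. -/
def momentFiber {N : ℕ} (G : SymMat N) : Set (Measure (EuclideanSpace ℝ (Fin N))) :=
  {μ | IsProbabilityMeasure μ ∧ MemLp id 2 μ ∧
    ∀ i j, ∫ x, x i * x j ∂μ = (G : Matrix (Fin N) (Fin N) ℝ) i j}

/-- `F[G] = sup { H(μ) - ∫ U dμ | μ ∈ 𝒢⁻¹(G) }`, equal to `-∞` if the fiber is empty. -/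
noncomputable def dualFn {N : ℕ} (U : EuclideanSpace ℝ (Fin N) → ℝ) (G : SymMat N) : EReal :=
  ⨆ μ ∈ momentFiber G, (entropy μ - extIntegral μ U)

/-- The concave conjugate `f_*(Y) = inf_X (⟨X, Y⟩ - f(X))` with respect to `⟨X, Y⟩ = ½ Tr[X Y]`. -/
noncomputable def concaveConj {N : ℕ} (f : SymMat N → EReal) (Y : SymMat N) : EReal :=
  ⨅ X : SymMat N, ((halfTrace X Y : ℝ) : EReal) - f X

/-- The symmetric matrix `E^{(ij)}` with entries `δ_ik δ_jl + δ_il δ_jk`. -/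
def symUnit {N : ℕ} (i j : Fin N) : SymMat N :=
  ⟨Matrix.single i j 1 + Matrix.single j i 1, by
    change Matrix.IsSymm _
    simp [Matrix.IsSymm, Matrix.transpose_add, Matrix.transpose_single, add_comm]⟩

theorem symUnit_comm {N : ℕ} (i j : Fin N) : (symUnit i j : SymMat N) = symUnit j i :=
  Subtype.ext (add_comm _ _)

/-- The gradient of a function of symmetric matrices:
`(∇f)_{ij}(A) = lim_{δ → 0} (f(A + δ E^{(ij)}) - f(A)) / δ`. This is the gradient with respect to the
inner product `½ Tr[A G]`. -/
noncomputable def symGrad {N : ℕ} (f : SymMat N → ℝ) (A : SymMat N) : SymMat N :=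
  ⟨Matrix.of fun i j => lineDeriv ℝ f A (symUnit i j), by
    change Matrix.IsSymm _
    ext i j
    simp [symUnit_comm i j]⟩

end LuttingerWard

namespace LuttingerWard

open Filter Topology

/-! Everything comes from one inequality and its equality case. For μ in the fiber over G and A in
dom Ω, Gibbs' inequality relative to the density exp(-½xᵀAx - U)/Z[A] gives H(μ) - ∫U dμ ≤ ½Tr[AG] -
Ω[A], because the cross entropy sees μ only through G and ∫U dμ (`entropy_sub_le`). The Gibbs
measure itself gives equality (`entropy_gibbsMeasure_sub`). Outside dom Ω there is no Gibbs measure,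
so the variational formula uses Gibbs measures restricted to bounded sets that exhaust the space.

Conjugacy needs every positive definite G to be the second moment of a Gibbs measure. These moments
are ∇Ω, so one minimises ½Tr[AG] - Ω[A] over A. Fatou's lemma supplies lower semicontinuity and,
along sequences escaping to infinity, coercivity (`isBounded_expDual_sublevel`); openness of dom Ω
makes the minimiser an interior critical point. If G is not positive definite, both sides are -∞:
any measure in the fiber lives on a null hyperplane, and adding rank one matrices along the
degenerate direction sends Z to 0 without raising the trace term.

Openness of dom Ω also permits differentiating Z under the integral any number of times. Strict
convexity of exp, integrated, makes Ω strictly concave, hence ∇Ω injective. The Hessian of Ω is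
minus a variance of quadratic forms, so it is nondegenerate (`fderiv_symGrad_freeEnergy_injective`)
and the inverse function theorem makes (∇Ω)⁻¹ smooth. F is then smooth as an expression in (∇Ω)⁻¹,
and ∇F = (∇Ω)⁻¹ by an envelope argument (`symGrad_dualFn`). -/

/-- The topology of symmetric matrices in the form in which the normed space library expects it. -/
abbrev symMatTopology (N : ℕ) : TopologicalSpace (SymMat N) :=
  (inferInstance : NormedAddCommGroup (SymMat N)).toPseudoMetricSpace.toUniformSpace.toTopologicalSpace

attribute [local instance] symMatTopology

variable {N : ℕ} {U : EuclideanSpace ℝ (Fin N) → ℝ}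

/-! ### Quadratic forms and the trace pairing -/

theorem quadForm_eq_sum (A : SymMat N) (x : EuclideanSpace ℝ (Fin N)) :
    quadForm A x = ∑ i, ∑ j, (A : Matrix (Fin N) (Fin N) ℝ) i j * (x i * x j) := by
  simp only [quadForm, dotProduct, Matrix.mulVec, Finset.mul_sum]
  refine Finset.sum_congr rfl fun i _ => Finset.sum_congr rfl fun j _ => ?_
  ring

theorem SymMat.apply_comm (A : SymMat N) (i j : Fin N) :
    (A : Matrix (Fin N) (Fin N) ℝ) i j = (A : Matrix (Fin N) (Fin N) ℝ) j i :=
  (Matrix.IsSymm.apply A.2 i j).symm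

theorem halfTrace_eq_sum (A G : SymMat N) :
    halfTrace A G = (1 / 2) * ∑ i, ∑ j, (A : Matrix (Fin N) (Fin N) ℝ) i j *
      (G : Matrix (Fin N) (Fin N) ℝ) i j := by
  simp only [halfTrace, Matrix.trace, Matrix.diag, Matrix.mul_apply]
  congr 1
  refine Finset.sum_congr rfl fun i _ => Finset.sum_congr rfl fun j _ => ?_
  rw [SymMat.apply_comm G j i]

theorem halfTrace_add_left (A B G : SymMat N) :
    halfTrace (A + B) G = halfTrace A G + halfTrace B G := by
  simp [halfTrace, add_mul, Matrix.trace_add, mul_add]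

theorem halfTrace_smul_left (c : ℝ) (A G : SymMat N) :
    halfTrace (c • A) G = c * halfTrace A G := by
  simp [halfTrace]; ring

theorem halfTrace_add_right (A B G : SymMat N) :
    halfTrace A (B + G) = halfTrace A B + halfTrace A G := by
  simp [halfTrace, mul_add, Matrix.trace_add]

theorem halfTrace_smul_right (c : ℝ) (A G : SymMat N) :
    halfTrace A (c • G) = c * halfTrace A G := by
  simp [halfTrace]; ring

theorem halfTrace_comm (A G : SymMat N) : halfTrace A G = halfTrace G A := by
  rw [halfTrace, halfTrace, Matrix.trace_mul_comm]

/-- The trace pairing as a continuous linear functional of its first argument. -/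
noncomputable def halfTraceCLM (G : SymMat N) : SymMat N →L[ℝ] ℝ :=
  LinearMap.toContinuousLinearMap
    { toFun := fun A => halfTrace A G
      map_add' := fun A B => halfTrace_add_left A B G
      map_smul' := fun c A => halfTrace_smul_left c A G }

@[simp]
theorem halfTraceCLM_apply (G A : SymMat N) : halfTraceCLM G A = halfTrace A G := rfl

/-- The factor ½ of the pairing cancels the doubling in `symUnit`, on and off the diagonal alike.
This makes `symGrad` the gradient for this pairing. -/
theorem halfTrace_symUnit_left (i j : Fin N) (G : SymMat N) :
    halfTrace (symUnit i j) G = (G : Matrix (Fin N) (Fin N) ℝ) i j := by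
  simp only [halfTrace, symUnit, add_mul, Matrix.trace_add, Matrix.trace_single_mul]
  simp [SymMat.apply_comm G j i]
  ring

theorem quadForm_symUnit (i j : Fin N) (x : EuclideanSpace ℝ (Fin N)) :
    quadForm (symUnit i j) x = 2 * (x i * x j) := by
  simp [quadForm, symUnit, Matrix.add_mulVec, Matrix.single_mulVec, dotProduct,
    Function.update_apply, mul_add, Finset.sum_add_distrib]
  ring

theorem quadForm_add (A B : SymMat N) (x : EuclideanSpace ℝ (Fin N)) :
    quadForm (A + B) x = quadForm A x + quadForm B x := by
  simp [quadForm, Matrix.add_mulVec, dotProduct_add]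

theorem quadForm_smul (c : ℝ) (A : SymMat N) (x : EuclideanSpace ℝ (Fin N)) :
    quadForm (c • A) x = c * quadForm A x := by
  simp [quadForm, Matrix.smul_mulVec, dotProduct_smul]

theorem quadForm_sub (A B : SymMat N) (x : EuclideanSpace ℝ (Fin N)) :
    quadForm (A - B) x = quadForm A x - quadForm B x := by
  simp [quadForm, Matrix.sub_mulVec, dotProduct_sub]

theorem quadForm_smul_vec (A : SymMat N) (t : ℝ) (x : EuclideanSpace ℝ (Fin N)) :
    quadForm A (t • x) = t ^ 2 * quadForm A x := by
  simp only [quadForm_eq_sum, Finset.mul_sum, PiLp.smul_apply, smul_eq_mul]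
  refine Finset.sum_congr rfl fun i _ => Finset.sum_congr rfl fun j _ => ?_
  ring

@[simp]
theorem quadForm_zero_vec (A : SymMat N) : quadForm A 0 = 0 := by simp [quadForm]

/-- The quadratic form at a vector, as a continuous linear functional of the matrix. -/
noncomputable def quadFormCLM (x : EuclideanSpace ℝ (Fin N)) : SymMat N →L[ℝ] ℝ :=
  LinearMap.toContinuousLinearMap
    { toFun := fun A => quadForm A x
      map_add' := fun A B => quadForm_add A B x
      map_smul' := fun c A => quadForm_smul c A x }

theorem continuous_quadForm (A : SymMat N) : Continuous (quadForm A) := by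
  simp only [funext (quadForm_eq_sum A)]
  fun_prop

theorem continuous_quadForm_left (x : EuclideanSpace ℝ (Fin N)) :
    Continuous fun A : SymMat N => quadForm A x := (quadFormCLM x).continuous

theorem abs_quadForm_le (A : SymMat N) (x : EuclideanSpace ℝ (Fin N)) :
    |quadForm A x| ≤ (N : ℝ) ^ 2 * ‖A‖ * ‖x‖ ^ 2 := by
  rw [quadForm_eq_sum]
  calc |∑ i, ∑ j, (A : Matrix (Fin N) (Fin N) ℝ) i j * (x i * x j)|
      ≤ ∑ i : Fin N, ∑ j : Fin N, ‖A‖ * ‖x‖ ^ 2 := by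
        refine (Finset.abs_sum_le_sum_abs _ _).trans (Finset.sum_le_sum fun i _ => ?_)
        refine (Finset.abs_sum_le_sum_abs _ _).trans (Finset.sum_le_sum fun j _ => ?_)
        rw [abs_mul, abs_mul, sq]
        have h1 : |(A : Matrix (Fin N) (Fin N) ℝ) i j| ≤ ‖A‖ :=
          Matrix.norm_entry_le_entrywise_sup_norm (A : Matrix (Fin N) (Fin N) ℝ)
        have h2 : ∀ k, |x k| ≤ ‖x‖ := fun k => PiLp.norm_apply_le x k
        gcongr
        · exact h2 i
        · exact h2 j
    _ = (N : ℝ) ^ 2 * ‖A‖ * ‖x‖ ^ 2 := by simp; ring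

/-- The identity matrix. -/
def symOne (N : ℕ) : SymMat N := ⟨1, Matrix.isSymm_one⟩

@[simp]
theorem quadForm_symOne (x : EuclideanSpace ℝ (Fin N)) : quadForm (symOne N) x = ‖x‖ ^ 2 := by
  rw [EuclideanSpace.real_norm_sq_eq]
  simp [quadForm, symOne, dotProduct, sq]

/-- A symmetric matrix is determined by its quadratic form. -/
theorem eq_zero_of_quadForm_eq_zero {A : SymMat N} (h : ∀ x, quadForm A x = 0) : A = 0 := by
  ext i j
  have hA : ∀ x : Fin N → ℝ, x ⬝ᵥ ((A : Matrix (Fin N) (Fin N) ℝ) *ᵥ x) = 0 := fun x =>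
    h (WithLp.toLp 2 x)
  have hi := hA (Pi.single i 1)
  have hj := hA (Pi.single j 1)
  have hij := hA (Pi.single i 1 + Pi.single j 1)
  simp [Matrix.mulVec_add, add_dotProduct] at hi hj hij
  have := SymMat.apply_comm A i j
  simp
  linarith

theorem isHermitian (A : SymMat N) : (A : Matrix (Fin N) (Fin N) ℝ).IsHermitian := by
  rw [Matrix.IsHermitian, Matrix.conjTranspose_eq_transpose_of_trivial]; exact A.2

theorem mem_posSemidefCone {G : SymMat N} : G ∈ posSemidefCone N ↔ ∀ x, 0 ≤ quadForm G x := by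
  constructor
  · intro h x
    exact (Matrix.posSemidef_iff_dotProduct_mulVec.1 h).2 x.ofLp
  · intro h
    exact Matrix.posSemidef_iff_dotProduct_mulVec.2 ⟨isHermitian G, fun x =>
      h (WithLp.toLp 2 x)⟩

theorem mem_posDefCone {G : SymMat N} : G ∈ posDefCone N ↔ ∀ x, x ≠ 0 → 0 < quadForm G x := by
  constructor
  · intro h x hx
    exact (Matrix.posDef_iff_dotProduct_mulVec.1 h).2 (x := x.ofLp) (by simpa using hx)
  · intro h
    exact Matrix.posDef_iff_dotProduct_mulVec.2 ⟨isHermitian G, fun {x} hx =>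
      h (WithLp.toLp 2 x) (by simpa using hx)⟩

/-- The rank one matrix `v vᵀ`. -/
def symRankOne (v : EuclideanSpace ℝ (Fin N)) : SymMat N :=
  ⟨Matrix.vecMulVec v.ofLp v.ofLp, by
    change Matrix.IsSymm _
    ext i j
    simp [Matrix.vecMulVec, mul_comm]⟩

theorem quadForm_symRankOne (v x : EuclideanSpace ℝ (Fin N)) :
    quadForm (symRankOne v) x = (∑ i, v i * x i) ^ 2 := by
  rw [quadForm_eq_sum, sq, Finset.sum_mul_sum]
  refine Finset.sum_congr rfl fun i _ => Finset.sum_congr rfl fun j _ => ?_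
  simp [symRankOne, Matrix.vecMulVec]
  ring

theorem halfTrace_symRankOne (v : EuclideanSpace ℝ (Fin N)) (G : SymMat N) :
    halfTrace (symRankOne v) G = (1 / 2) * quadForm G v := by
  rw [halfTrace_eq_sum, quadForm_eq_sum]
  congr 1
  refine Finset.sum_congr rfl fun i _ => Finset.sum_congr rfl fun j _ => ?_
  simp [symRankOne, Matrix.vecMulVec]
  ring

/-! ### Weights and the effective domain of the free energy -/

/-- The Gibbs weight `exp(-½ xᵀ A x - U x)`. -/
noncomputable def gibbsWeight (U : EuclideanSpace ℝ (Fin N) → ℝ) (A : SymMat N)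
    (x : EuclideanSpace ℝ (Fin N)) : ℝ :=
  Real.exp (-(1 / 2) * quadForm A x - U x)

theorem gibbsWeight_pos (A : SymMat N) (x : EuclideanSpace ℝ (Fin N)) : 0 < gibbsWeight U A x :=
  Real.exp_pos _

theorem measurable_gibbsWeight (hU : Measurable U) (A : SymMat N) :
    Measurable (gibbsWeight U A) :=
  Real.measurable_exp.comp (((continuous_quadForm A).measurable.const_mul _).sub hU)

/-- The partition function as a real number. -/
noncomputable def realPartition (U : EuclideanSpace ℝ (Fin N) → ℝ) (A : SymMat N) : ℝ :=
  ∫ x, gibbsWeight U A x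

theorem partitionFn_eq_lintegral (A : SymMat N) :
    partitionFn U A = ∫⁻ x, ENNReal.ofReal (gibbsWeight U A x) := rfl

/-- The weight is positive everywhere and Lebesgue measure is nonzero, also for `N = 0`. -/
theorem partitionFn_ne_zero (hU : Measurable U) (A : SymMat N) : partitionFn U A ≠ 0 := by
  rw [partitionFn_eq_lintegral, Ne, lintegral_eq_zero_iff
    (measurable_gibbsWeight hU A).ennreal_ofReal]
  intro h
  have : (∀ᵐ x : EuclideanSpace ℝ (Fin N), False) := by
    filter_upwards [h] with x hx
    have := gibbsWeight_pos (U := U) A x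
    simp only [Pi.zero_apply, ENNReal.ofReal_eq_zero] at hx
    linarith
  simp only [eventually_false_iff_eq_bot, ae_eq_bot] at this
  exact NeZero.ne volume this

theorem freeEnergy_ne_top (hU : Measurable U) (A : SymMat N) : freeEnergy U A ≠ ⊤ := by
  rw [freeEnergy, Ne, EReal.neg_eq_top_iff, ENNReal.log_eq_bot_iff]
  exact partitionFn_ne_zero hU A

theorem mem_effDom_iff {A : SymMat N} : A ∈ effDom (freeEnergy U) ↔ partitionFn U A ≠ ⊤ := by
  rw [effDom, Set.mem_ofPred_eq, bot_lt_iff_ne_bot, freeEnergy, Ne, EReal.neg_eq_bot_iff,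
    ENNReal.log_eq_top_iff]

theorem mem_effDom_iff_integrable (hU : Measurable U) {A : SymMat N} :
    A ∈ effDom (freeEnergy U) ↔ Integrable (gibbsWeight U A) := by
  rw [mem_effDom_iff, partitionFn_eq_lintegral,
    lintegral_ofReal_ne_top_iff_integrable (measurable_gibbsWeight hU A).aestronglyMeasurable
      (Eventually.of_forall fun x => (gibbsWeight_pos A x).le)]

theorem partitionFn_eq_ofReal (hU : Measurable U) {A : SymMat N}
    (hA : A ∈ effDom (freeEnergy U)) : partitionFn U A = ENNReal.ofReal (realPartition U A) := by
  rw [partitionFn_eq_lintegral, realPartition, ofReal_integral_eq_lintegral_ofReal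
    ((mem_effDom_iff_integrable hU).1 hA) (Eventually.of_forall fun x => (gibbsWeight_pos A x).le)]

theorem realPartition_pos (hU : Measurable U) {A : SymMat N}
    (hA : A ∈ effDom (freeEnergy U)) : 0 < realPartition U A := by
  have := partitionFn_ne_zero hU A
  rw [partitionFn_eq_ofReal hU hA, Ne, ENNReal.ofReal_eq_zero, not_le] at this
  exact this

theorem freeEnergy_eq_coe (hU : Measurable U) {A : SymMat N}
    (hA : A ∈ effDom (freeEnergy U)) :
    freeEnergy U A = ((-Real.log (realPartition U A) : ℝ) : EReal) := by
  rw [freeEnergy, partitionFn_eq_ofReal hU hA,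
    ENNReal.log_ofReal_of_pos (realPartition_pos hU hA), EReal.coe_neg]

theorem toReal_freeEnergy (hU : Measurable U) {A : SymMat N}
    (hA : A ∈ effDom (freeEnergy U)) :
    (freeEnergy U A).toReal = -Real.log (realPartition U A) := by
  rw [freeEnergy_eq_coe hU hA, EReal.toReal_coe]

theorem integrable_exp_neg_mul_norm_sq {c : ℝ} (hc : 0 < c) :
    Integrable fun x : EuclideanSpace ℝ (Fin N) => Real.exp (-c * ‖x‖ ^ 2) := by
  have h := (GaussianFourier.integrable_cexp_neg_mul_sq_norm_add (b := (c : ℂ)) (by simpa using hc)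
    0 (0 : EuclideanSpace ℝ (Fin N))).norm
  refine h.congr (Eventually.of_forall fun x => ?_)
  simp only [Complex.norm_exp]
  congr 1
  simp [← Complex.ofReal_pow, ← Complex.ofReal_mul]

theorem isOpen_effDom (hU : WeakGrowth U) : IsOpen (effDom (freeEnergy U)) := hU.isOpen_dom

theorem exists_mem_effDom (hU : WeakGrowth U) : ∃ A, A ∈ effDom (freeEnergy U) := by
  obtain ⟨C, hC⟩ := hU.bound
  -- With this multiple of the identity the growth bound leaves an exponent of at most |C| - ‖x‖².
  refine ⟨(2 * (|C| + 1)) • symOne N, (mem_effDom_iff_integrable hU.measurable).2 ?_⟩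
  refine ((integrable_exp_neg_mul_norm_sq one_pos).const_mul (Real.exp |C|)).mono'
    (measurable_gibbsWeight hU.measurable _).aestronglyMeasurable (Eventually.of_forall fun x => ?_)
  rw [Real.norm_of_nonneg (gibbsWeight_pos _ x).le, gibbsWeight, ← Real.exp_add, Real.exp_le_exp,
    quadForm_smul, quadForm_symOne]
  nlinarith [hC x, le_abs_self C, sq_nonneg ‖x‖]

/-- The constant comes from a single term of the exponential series, (c(1+t))^k/k! ≤ exp(c(1+t)). -/
theorem one_add_pow_mul_exp_le {c : ℝ} (hc : 0 < c) (k : ℕ) :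
    ∃ M : ℝ, 0 ≤ M ∧ ∀ t : ℝ, 0 ≤ t → (1 + t) ^ k * Real.exp (-c * t) ≤ M := by
  refine ⟨k.factorial * (Real.exp c / c ^ k), by positivity, fun t ht => ?_⟩
  have h := Real.pow_div_factorial_le_exp (x := c * (1 + t)) (by positivity) k
  rw [div_le_iff₀ (by positivity), mul_pow] at h
  have h2 : Real.exp (c * (1 + t)) * Real.exp (-c * t) = Real.exp c := by
    rw [← Real.exp_add]; ring_nf
  rw [mul_div_assoc', le_div_iff₀ (by positivity)]
  calc (1 + t) ^ k * Real.exp (-c * t) * c ^ k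
      = c ^ k * (1 + t) ^ k * Real.exp (-c * t) := by ring
    _ ≤ Real.exp (c * (1 + t)) * k.factorial * Real.exp (-c * t) := by gcongr
    _ = k.factorial * Real.exp c := by rw [← h2]; ring

/-- Near a point of the (open) effective domain, Gibbs weights times polynomials are dominated by
one integrable function. -/
theorem exists_bound_gibbsWeight (hU : WeakGrowth U) {A : SymMat N}
    (hA : A ∈ effDom (freeEnergy U)) (k : ℕ) :
    ∃ ε > 0, ∃ b : EuclideanSpace ℝ (Fin N) → ℝ, Integrable b ∧
      ∀ B ∈ Metric.ball A ε, ∀ x, (1 + ‖x‖ ^ 2) ^ k * gibbsWeight U B x ≤ b x := by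
  -- Openness leaves room to pass from A to A - δI. The weight there is integrable and exceeds the
  -- weight at A by a factor exp(δ‖x‖²/2), which can pay for polynomials and for moving A.
  have hcont : Continuous fun δ : ℝ => A - δ • symOne N := by fun_prop
  have h0 : A - (0 : ℝ) • symOne N ∈ effDom (freeEnergy U) := by simpa using hA
  have hmem : {δ : ℝ | A - δ • symOne N ∈ effDom (freeEnergy U)} ∈ 𝓝 (0 : ℝ) :=
    hcont.continuousAt.preimage_mem_nhds ((isOpen_effDom hU).mem_nhds h0)
  obtain ⟨r, hr, hball⟩ := Metric.mem_nhds_iff.1 hmem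
  have hδ : A - (r / 2) • symOne N ∈ effDom (freeEnergy U) :=
    hball (by simp [abs_of_pos hr]; linarith)
  set δ := r / 2 with hδdef
  have hδpos : 0 < δ := by positivity
  obtain ⟨M, hM, hbd⟩ := one_add_pow_mul_exp_le (c := δ / 4) (by positivity) k
  -- In a ball of this radius the form of B - A is at most δ‖x‖²/2, costing half of the gain and
  -- leaving exp(-δ‖x‖²/4). The `+ 1` covers `N = 0`.
  refine ⟨δ / (2 * ((N : ℝ) ^ 2 + 1)), by positivity, fun x => M * gibbsWeight U
    (A - δ • symOne N) x, ((mem_effDom_iff_integrable hU.measurable).1 hδ).const_mul M, ?_⟩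
  intro B hB x
  have hBA : ‖B - A‖ < δ / (2 * ((N : ℝ) ^ 2 + 1)) := by simpa [dist_eq_norm] using hB
  have h1 : |quadForm (B - A) x| ≤ δ / 2 * ‖x‖ ^ 2 := by
    refine (abs_quadForm_le _ x).trans ?_
    gcongr
    calc (N : ℝ) ^ 2 * ‖B - A‖ ≤ ((N : ℝ) ^ 2 + 1) * (δ / (2 * ((N : ℝ) ^ 2 + 1))) := by
          gcongr; linarith
      _ = δ / 2 := by field_simp
  rw [quadForm_sub] at h1
  have h2 : gibbsWeight U B x ≤
      Real.exp (-(δ / 4) * ‖x‖ ^ 2) * gibbsWeight U (A - δ • symOne N) x := by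
    rw [gibbsWeight, gibbsWeight, ← Real.exp_add, Real.exp_le_exp, quadForm_sub, quadForm_smul,
      quadForm_symOne]
    nlinarith [(abs_le.1 h1).1]
  calc (1 + ‖x‖ ^ 2) ^ k * gibbsWeight U B x
      ≤ (1 + ‖x‖ ^ 2) ^ k *
        (Real.exp (-(δ / 4) * ‖x‖ ^ 2) * gibbsWeight U (A - δ • symOne N) x) := by gcongr
    _ = ((1 + ‖x‖ ^ 2) ^ k * Real.exp (-(δ / 4) * ‖x‖ ^ 2)) *
        gibbsWeight U (A - δ • symOne N) x := by ring
    _ ≤ M * gibbsWeight U (A - δ • symOne N) x :=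
        mul_le_mul_of_nonneg_right (hbd _ (sq_nonneg _)) (gibbsWeight_pos _ x).le

theorem integrable_pow_mul_gibbsWeight (hU : WeakGrowth U) {A : SymMat N}
    (hA : A ∈ effDom (freeEnergy U)) (k : ℕ) :
    Integrable fun x => (1 + ‖x‖ ^ 2) ^ k * gibbsWeight U A x := by
  obtain ⟨ε, hε, b, hb, hbd⟩ := exists_bound_gibbsWeight hU hA k
  refine hb.mono' ?_ (Eventually.of_forall fun x => ?_)
  · have := measurable_gibbsWeight hU.measurable A
    exact (((measurable_norm.pow_const 2).const_add 1).pow_const k |>.mul this).aestronglyMeasurable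
  · rw [Real.norm_of_nonneg (mul_nonneg (by positivity) (gibbsWeight_pos A x).le)]
    exact hbd A (Metric.mem_ball_self hε) x

/-! ### Smoothness of exponential integrals -/

section ExpMoments

variable {E : Type} [NormedAddCommGroup E] [NormedSpace ℝ E] {X : Type}
  {q : X → E →L[ℝ] ℝ} {u p : X → ℝ} {D : Set E}

theorem hasFDerivAt_exp_sub (A : E) (x : X) :
    HasFDerivAt (fun B => Real.exp (q x B - u x)) (Real.exp (q x A - u x) • q x) A :=
  ((q x).hasFDerivAt.sub_const (u x)).exp

theorem norm_smulRight_le {V : Type} [NormedAddCommGroup V] [NormedSpace ℝ V] {g : X → V}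
    {C c : ℝ} {k : ℕ} (hqc : ∀ x, ‖q x‖ ≤ c * p x)
    (hC : ∀ x, ‖g x‖ ≤ C * p x ^ k) (x : X) :
    ‖(q x).smulRight (g x)‖ ≤ c * C * p x ^ (k + 1) := by
  rw [ContinuousLinearMap.norm_smulRight_apply]
  calc ‖q x‖ * ‖g x‖ ≤ (c * p x) * (C * p x ^ k) :=
        mul_le_mul (hqc x) (hC x) (norm_nonneg _) ((norm_nonneg _).trans (hqc x))
    _ = c * C * p x ^ (k + 1) := by ring

variable [MeasurableSpace X] {μ : Measure X}

/-- The exponential moment `∫ g(x) exp(q(x) A - u(x)) dμ(x)`. -/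
noncomputable def expMoment {V : Type} [NormedAddCommGroup V] [NormedSpace ℝ V]
    (μ : Measure X) (q : X → E →L[ℝ] ℝ) (u : X → ℝ) (g : X → V) (A : E) : V :=
  ∫ x, Real.exp (q x A - u x) • g x ∂μ

/-- On `D`, exponential weights times powers of the gauge function `p` are locally dominated. -/
def LocallyDominated (μ : Measure X) (q : X → E →L[ℝ] ℝ) (u p : X → ℝ) (D : Set E) : Prop :=
  ∀ A ∈ D, ∀ k : ℕ, ∃ ε > 0, ∃ b : X → ℝ, Integrable b μ ∧
    ∀ B ∈ Metric.ball A ε, ∀ x, p x ^ k * Real.exp (q x B - u x) ≤ b x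

section

variable {V : Type} [NormedAddCommGroup V] [NormedSpace ℝ V] {g : X → V} {C c : ℝ} {k : ℕ}

theorem aestronglyMeasurable_exp_smul (hq : AEStronglyMeasurable q μ)
    (hu : AEStronglyMeasurable u μ) (hg : AEStronglyMeasurable g μ) (A : E) :
    AEStronglyMeasurable (fun x => Real.exp (q x A - u x) • g x) μ :=
  (Real.continuous_exp.comp_aestronglyMeasurable ((hq.apply_continuousLinearMap A).sub hu)).smul hg

theorem integrable_exp_smul (hdom : LocallyDominated μ q u p D) (hp : ∀ x, 0 < p x)
    (hq : AEStronglyMeasurable q μ) (hu : AEStronglyMeasurable u μ)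
    (hg : AEStronglyMeasurable g μ) (hC : ∀ x, ‖g x‖ ≤ C * p x ^ k) {A : E} (hA : A ∈ D) :
    Integrable (fun x => Real.exp (q x A - u x) • g x) μ := by
  obtain ⟨ε, hε, b, hb, hbd⟩ := hdom A hA k
  refine (hb.const_mul C).mono' (aestronglyMeasurable_exp_smul hq hu hg A)
    (Eventually.of_forall fun x => ?_)
  have hC0 : 0 ≤ C := nonneg_of_mul_nonneg_left ((norm_nonneg _).trans (hC x)) (pow_pos (hp x) _)
  rw [norm_smul, Real.norm_of_nonneg (Real.exp_pos _).le]
  calc Real.exp (q x A - u x) * ‖g x‖ ≤ Real.exp (q x A - u x) * (C * p x ^ k) := by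
        gcongr; exact hC x
    _ = C * (p x ^ k * Real.exp (q x A - u x)) := by ring
    _ ≤ C * b x := by gcongr; exact hbd A (Metric.mem_ball_self hε) x

/-- Differentiation under the integral reproduces an exponential moment, with `g` replaced by `q ⊗
g` and the growth degree raised by one; this closure drives the induction for smoothness. -/
theorem hasFDerivAt_expMoment (hdom : LocallyDominated μ q u p D) (hp : ∀ x, 0 < p x)
    (hq : AEStronglyMeasurable q μ) (hu : AEStronglyMeasurable u μ) (hqc : ∀ x, ‖q x‖ ≤ c * p x)
    (hg : AEStronglyMeasurable g μ) (hC : ∀ x, ‖g x‖ ≤ C * p x ^ k) {A : E} (hA : A ∈ D) :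
    HasFDerivAt (expMoment μ q u g) (expMoment μ q u (fun x => (q x).smulRight (g x)) A) A := by
  obtain ⟨ε, hε, b, hb, hbd⟩ := hdom A hA (k + 1)
  have hmeas : AEStronglyMeasurable (fun x => (q x).smulRight (g x)) μ :=
    (ContinuousLinearMap.smulRightL ℝ E V).aestronglyMeasurable_comp₂ hq hg
  refine hasFDerivAt_integral_of_dominated_of_fderiv_le (F' := fun B x =>
    Real.exp (q x B - u x) • (q x).smulRight (g x)) (bound := fun x => c * C * b x)
    (Metric.ball_mem_nhds A hε) ?_ (integrable_exp_smul hdom hp hq hu hg hC hA) ?_ ?_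
    (hb.const_mul _) ?_
  · exact Eventually.of_forall fun B => aestronglyMeasurable_exp_smul hq hu hg B
  · exact aestronglyMeasurable_exp_smul hq hu hmeas A
  · refine Eventually.of_forall fun x B hB => ?_
    have hC0 : 0 ≤ c * C := nonneg_of_mul_nonneg_left
      ((norm_nonneg _).trans (norm_smulRight_le hqc hC x)) (pow_pos (hp x) _)
    rw [norm_smul, Real.norm_of_nonneg (Real.exp_pos _).le]
    calc Real.exp (q x B - u x) * ‖(q x).smulRight (g x)‖
        ≤ Real.exp (q x B - u x) * (c * C * p x ^ (k + 1)) := by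
          gcongr; exact norm_smulRight_le hqc hC x
      _ = c * C * (p x ^ (k + 1) * Real.exp (q x B - u x)) := by ring
      _ ≤ c * C * b x := by gcongr; exact hbd B hB x
  · refine Eventually.of_forall fun x B _ => ?_
    refine ((hasFDerivAt_exp_sub B x).smul_const (g x)).congr_fderiv ?_
    ext v
    simp [smul_smul]

end

theorem expMoment_smulRight_apply (hdom : LocallyDominated μ q u p D) (hp : ∀ x, 0 < p x)
    (hq : AEStronglyMeasurable q μ) (hu : AEStronglyMeasurable u μ) {c C : ℝ} {k : ℕ}
    (hqc : ∀ x, ‖q x‖ ≤ c * p x) {g : X → ℝ}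
    (hg : AEStronglyMeasurable g μ) (hC : ∀ x, ‖g x‖ ≤ C * p x ^ k) {A : E} (hA : A ∈ D) (B : E) :
    expMoment μ q u (fun x => (q x).smulRight (g x)) A B =
      expMoment μ q u (fun x => q x B * g x) A := by
  refine (ContinuousLinearMap.integral_apply (integrable_exp_smul hdom hp hq hu
    ((ContinuousLinearMap.smulRightL ℝ E ℝ).aestronglyMeasurable_comp₂ hq hg)
    (norm_smulRight_le hqc hC) hA) B).trans ?_
  rfl

theorem contDiffOn_expMoment_nat (hdom : LocallyDominated μ q u p D) (hD : IsOpen D)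
    (hp : ∀ x, 0 < p x) (hq : AEStronglyMeasurable q μ) (hu : AEStronglyMeasurable u μ) {c : ℝ}
    (hqc : ∀ x, ‖q x‖ ≤ c * p x) (n : ℕ) :
    ∀ {V : Type} [NormedAddCommGroup V] [NormedSpace ℝ V] {g : X → V},
      AEStronglyMeasurable g μ → ∀ {C : ℝ} {k : ℕ}, (∀ x, ‖g x‖ ≤ C * p x ^ k) →
      ContDiffOn ℝ n (expMoment μ q u g) D := by
  induction n with
  | zero =>
    intro V _ _ g hg C k hC
    exact contDiffOn_zero.2 fun A hA =>
      (hasFDerivAt_expMoment hdom hp hq hu hqc hg hC hA).continuousAt.continuousWithinAt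
  | succ n ih =>
    intro V _ _ g hg C k hC
    rw [Nat.cast_succ, contDiffOn_succ_iff_fderiv_of_isOpen hD]
    refine ⟨fun A hA => (hasFDerivAt_expMoment hdom hp hq hu hqc hg hC hA).differentiableAt
      |>.differentiableWithinAt, by simp, ?_⟩
    -- The derivative takes values in `E →L[ℝ] V`, so the induction hypothesis must hold for all
    -- target spaces and all growth degrees.
    exact (ih ((ContinuousLinearMap.smulRightL ℝ E V).aestronglyMeasurable_comp₂ hq hg)
      (norm_smulRight_le hqc hC)).congr fun A hA =>
        (hasFDerivAt_expMoment hdom hp hq hu hqc hg hC hA).fderiv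

/-- Exponential moments are smooth where they are locally dominated. -/
theorem contDiffOn_expMoment (hdom : LocallyDominated μ q u p D) (hD : IsOpen D)
    (hp : ∀ x, 0 < p x) (hq : AEStronglyMeasurable q μ) (hu : AEStronglyMeasurable u μ) {c : ℝ}
    (hqc : ∀ x, ‖q x‖ ≤ c * p x) {V : Type} [NormedAddCommGroup V] [NormedSpace ℝ V] {g : X → V}
    (hg : AEStronglyMeasurable g μ) {C : ℝ} {k : ℕ} (hC : ∀ x, ‖g x‖ ≤ C * p x ^ k) :
    ContDiffOn ℝ ∞ (expMoment μ q u g) D :=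
  contDiffOn_infty.2 fun n => contDiffOn_expMoment_nat hdom hD hp hq hu hqc n hg hC

end ExpMoments

/-! ### Smoothness of the free energy -/

/-- The unnormalised Gibbs moment `∫ g(x) exp(-½ xᵀ A x - U(x)) dx`. -/
noncomputable def gibbsMoment (U : EuclideanSpace ℝ (Fin N) → ℝ) (g : EuclideanSpace ℝ (Fin N) → ℝ)
    (A : SymMat N) : ℝ :=
  ∫ x, gibbsWeight U A x * g x

theorem locallyDominated_quadForm (hU : WeakGrowth U) :
    LocallyDominated volume (fun x => (-(1 / 2) : ℝ) • quadFormCLM x) U (fun x => 1 + ‖x‖ ^ 2)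
      (effDom (freeEnergy U)) :=
  fun _ hA k => exists_bound_gibbsWeight hU hA k

theorem continuous_smul_quadFormCLM :
    Continuous fun x : EuclideanSpace ℝ (Fin N) => (-(1 / 2) : ℝ) • quadFormCLM x :=
  continuous_clm_apply.2 fun A => (continuous_quadForm A).const_mul (-(1 / 2))

theorem norm_smul_quadFormCLM_le (x : EuclideanSpace ℝ (Fin N)) :
    ‖(-(1 / 2) : ℝ) • quadFormCLM x‖ ≤ (N : ℝ) ^ 2 * (1 + ‖x‖ ^ 2) := by
  refine ContinuousLinearMap.opNorm_le_bound _ (by positivity) fun A => ?_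
  have h := abs_quadForm_le A x
  have h2 : 0 ≤ (N : ℝ) ^ 2 * ‖A‖ := by positivity
  change ‖-(1 / 2) * quadForm A x‖ ≤ _
  rw [norm_mul, Real.norm_eq_abs, Real.norm_eq_abs, abs_neg, abs_of_pos (by norm_num)]
  nlinarith [sq_nonneg ‖x‖, mul_nonneg h2 (sq_nonneg ‖x‖)]

theorem integrable_gibbsWeight_mul (hU : WeakGrowth U) {g : EuclideanSpace ℝ (Fin N) → ℝ}
    (hg : Continuous g) {C : ℝ} {k : ℕ} (hC : ∀ x, ‖g x‖ ≤ C * (1 + ‖x‖ ^ 2) ^ k) {A : SymMat N}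
    (hA : A ∈ effDom (freeEnergy U)) : Integrable fun x => gibbsWeight U A x * g x :=
  integrable_exp_smul (locallyDominated_quadForm hU) (fun x => by positivity)
    continuous_smul_quadFormCLM.aestronglyMeasurable hU.measurable.aestronglyMeasurable
    hg.aestronglyMeasurable hC hA

theorem contDiffOn_gibbsMoment (hU : WeakGrowth U) {g : EuclideanSpace ℝ (Fin N) → ℝ}
    (hg : Continuous g) {C : ℝ} {k : ℕ} (hC : ∀ x, ‖g x‖ ≤ C * (1 + ‖x‖ ^ 2) ^ k) :
    ContDiffOn ℝ ∞ (gibbsMoment U g) (effDom (freeEnergy U)) :=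
  contDiffOn_expMoment (locallyDominated_quadForm hU) (isOpen_effDom hU) (fun x => by positivity)
    continuous_smul_quadFormCLM.aestronglyMeasurable hU.measurable.aestronglyMeasurable
    norm_smul_quadFormCLM_le hg.aestronglyMeasurable hC

theorem hasFDerivAt_gibbsMoment (hU : WeakGrowth U) {g : EuclideanSpace ℝ (Fin N) → ℝ}
    (hg : Continuous g) {C : ℝ} {k : ℕ} (hC : ∀ x, ‖g x‖ ≤ C * (1 + ‖x‖ ^ 2) ^ k) {A : SymMat N}
    (hA : A ∈ effDom (freeEnergy U)) :
    ∃ L : SymMat N →L[ℝ] ℝ, HasFDerivAt (gibbsMoment U g) L A ∧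
      ∀ B, L B = -gibbsMoment U (fun x => 1 / 2 * quadForm B x * g x) A := by
  refine ⟨_, hasFDerivAt_expMoment (locallyDominated_quadForm hU) (fun x => by positivity)
    continuous_smul_quadFormCLM.aestronglyMeasurable hU.measurable.aestronglyMeasurable
    norm_smul_quadFormCLM_le hg.aestronglyMeasurable hC hA, fun B => ?_⟩
  rw [expMoment_smulRight_apply (locallyDominated_quadForm hU) (fun x => by positivity)
    continuous_smul_quadFormCLM.aestronglyMeasurable hU.measurable.aestronglyMeasurable
    norm_smul_quadFormCLM_le hg.aestronglyMeasurable hC hA, gibbsMoment, ← integral_neg]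
  refine integral_congr_ae (Eventually.of_forall fun x => ?_)
  change gibbsWeight U A x * (-(1 / 2) * quadForm B x * g x) = -(gibbsWeight U A x * (1 / 2 * quadForm B x * g x))
  ring

theorem realPartition_eq_gibbsMoment : realPartition U = gibbsMoment U fun _ => (1 : ℝ) := by
  ext A
  simp [realPartition, gibbsMoment]

theorem contDiffOn_realPartition (hU : WeakGrowth U) :
    ContDiffOn ℝ ∞ (realPartition U) (effDom (freeEnergy U)) := by
  rw [realPartition_eq_gibbsMoment]
  exact contDiffOn_gibbsMoment hU continuous_const (C := 1) (k := 0) (by simp)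

theorem contDiffOn_freeEnergy (hU : WeakGrowth U) :
    ContDiffOn ℝ ∞ (fun A => (freeEnergy U A).toReal) (effDom (freeEnergy U)) :=
  (((contDiffOn_realPartition hU).log fun _ hA => (realPartition_pos hU.measurable hA).ne').neg).congr
    fun _ hA => toReal_freeEnergy hU.measurable hA

/-- The Gibbs expectation `⟨½ xᵀ B x⟩_A`. -/
noncomputable def gibbsHalfForm (U : EuclideanSpace ℝ (Fin N) → ℝ) (A B : SymMat N) : ℝ :=
  (realPartition U A)⁻¹ * ∫ x, gibbsWeight U A x * (1 / 2 * quadForm B x)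

theorem hasFDerivAt_realPartition (hU : WeakGrowth U) {A : SymMat N}
    (hA : A ∈ effDom (freeEnergy U)) :
    ∃ L : SymMat N →L[ℝ] ℝ, HasFDerivAt (realPartition U) L A ∧
      ∀ B, L B = -∫ x, gibbsWeight U A x * (1 / 2 * quadForm B x) := by
  rw [realPartition_eq_gibbsMoment]
  obtain ⟨L, hL, hLB⟩ := hasFDerivAt_gibbsMoment hU (g := fun _ => 1) continuous_const (C := 1)
    (k := 0) (by simp) hA
  exact ⟨L, hL, fun B => by simp [hLB, gibbsMoment]⟩

theorem hasFDerivAt_freeEnergy (hU : WeakGrowth U) {A : SymMat N}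
    (hA : A ∈ effDom (freeEnergy U)) :
    ∃ L : SymMat N →L[ℝ] ℝ, HasFDerivAt (fun A => (freeEnergy U A).toReal) L A ∧
      ∀ B, L B = gibbsHalfForm U A B := by
  obtain ⟨L, hL, hLB⟩ := hasFDerivAt_realPartition hU hA
  refine ⟨_, ((hL.log (realPartition_pos hU.measurable hA).ne').neg).congr_of_eventuallyEq ?_, ?_⟩
  · filter_upwards [(isOpen_effDom hU).mem_nhds hA] with B hB
      using toReal_freeEnergy hU.measurable hB
  · intro B
    simp [hLB, gibbsHalfForm]

/-! ### Gradients with respect to the trace pairing -/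

theorem symGrad_apply_of_hasFDerivAt {f : SymMat N → ℝ} {L : SymMat N →L[ℝ] ℝ} {A : SymMat N}
    (h : HasFDerivAt f L A) (i j : Fin N) :
    (symGrad f A : Matrix (Fin N) (Fin N) ℝ) i j = L (symUnit i j) :=
  (h.hasLineDerivAt (symUnit i j)).lineDeriv

/-- The ½ corrects for each off-diagonal pair being listed twice and for `symUnit i i` having entry
2. -/
theorem eq_sum_symUnit (B : SymMat N) :
    B = (1 / 2 : ℝ) • ∑ i, ∑ j, (B : Matrix (Fin N) (Fin N) ℝ) i j • symUnit i j := by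
  ext k l
  have h1 : ∀ i j : Fin N, ((symUnit i j : SymMat N) : Matrix (Fin N) (Fin N) ℝ) k l =
      (if i = k ∧ j = l then 1 else 0) + if j = k ∧ i = l then 1 else 0 := fun i j => by
    simp [symUnit, Matrix.single_apply]
  simp [Matrix.sum_apply, h1, mul_add, Finset.sum_add_distrib, ite_and]
  rw [SymMat.apply_comm B l k]
  ring

/-- The derivative of a function is represented by its gradient. -/
theorem fderiv_apply_eq_halfTrace_symGrad {f : SymMat N → ℝ} {L : SymMat N →L[ℝ] ℝ}
    {A : SymMat N} (h : HasFDerivAt f L A) (B : SymMat N) :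
    L B = halfTrace B (symGrad f A) := by
  conv_lhs => rw [eq_sum_symUnit B]
  rw [halfTrace_eq_sum]
  simp [symGrad_apply_of_hasFDerivAt h, map_sum]

theorem symGrad_eq_of_hasFDerivAt {f : SymMat N → ℝ} {G A : SymMat N}
    (h : HasFDerivAt f (halfTraceCLM G) A) : symGrad f A = G := by
  ext i j
  rw [symGrad_apply_of_hasFDerivAt h, halfTraceCLM_apply, halfTrace_symUnit_left]

theorem halfTrace_symGrad_freeEnergy (hU : WeakGrowth U) {A : SymMat N}
    (hA : A ∈ effDom (freeEnergy U)) (B : SymMat N) :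
    halfTrace B (symGrad (fun A => (freeEnergy U A).toReal) A) = gibbsHalfForm U A B := by
  obtain ⟨L, hL, hLB⟩ := hasFDerivAt_freeEnergy hU hA
  rw [← hLB, fderiv_apply_eq_halfTrace_symGrad hL]

/-- The gradient of the free energy consists of the second moments of the Gibbs measure. -/
theorem symGrad_freeEnergy_apply (hU : WeakGrowth U) {A : SymMat N}
    (hA : A ∈ effDom (freeEnergy U)) (i j : Fin N) :
    (symGrad (fun A => (freeEnergy U A).toReal) A : Matrix (Fin N) (Fin N) ℝ) i j =
      (realPartition U A)⁻¹ * ∫ x, gibbsWeight U A x * (x i * x j) := by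
  obtain ⟨L, hL, hLB⟩ := hasFDerivAt_freeEnergy hU hA
  rw [symGrad_apply_of_hasFDerivAt hL, hLB, gibbsHalfForm]
  simp [quadForm_symUnit]

/-! ### The extended integral -/

section ExtIntegral

variable {E : Type*} [MeasurableSpace E] {μ : Measure E} {f : E → ℝ}

theorem extIntegral_of_integrable (hf : Integrable f μ) :
    extIntegral μ f = ((∫ x, f x ∂μ : ℝ) : EReal) := by
  have h1 : ∫⁻ x, ENNReal.ofReal (f x) ∂μ ≠ ⊤ := hf.lintegral_lt_top.ne
  have h2 : ∫⁻ x, ENNReal.ofReal (-f x) ∂μ ≠ ⊤ := hf.neg.lintegral_lt_top.ne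
  rw [extIntegral, integral_eq_lintegral_pos_part_sub_lintegral_neg_part hf, EReal.coe_sub,
    EReal.coe_ennreal_toReal h1, EReal.coe_ennreal_toReal h2]

/-- If the negative part has finite integral, either `f` is integrable or its integral is `+∞`. -/
theorem integrable_or_extIntegral_eq_top (hm : AEStronglyMeasurable f μ)
    (hf : ∫⁻ x, ENNReal.ofReal (-f x) ∂μ ≠ ⊤) : Integrable f μ ∨ extIntegral μ f = ⊤ := by
  rcases eq_or_ne (∫⁻ x, ENNReal.ofReal (f x) ∂μ) ⊤ with h | h
  · right
    rw [extIntegral, h, EReal.coe_ennreal_top, EReal.top_sub]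
    simpa using hf
  · left
    refine ⟨hm, ?_⟩
    have h3 : ∀ x, ‖f x‖ₑ = ENNReal.ofReal (f x) + ENNReal.ofReal (-f x) := fun x => by
      rw [← ofReal_norm, Real.norm_eq_abs]
      rcases le_total 0 (f x) with h0 | h0
      · rw [abs_of_nonneg h0, ENNReal.ofReal_of_nonpos (neg_nonpos.2 h0), add_zero]
      · rw [abs_of_nonpos h0, ENNReal.ofReal_of_nonpos h0, zero_add]
    rw [HasFiniteIntegral, lintegral_congr h3, lintegral_add_left' hm.aemeasurable.ennreal_ofReal]
    exact ENNReal.add_lt_top.2 ⟨h.lt_top, hf.lt_top⟩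

end ExtIntegral

/-! ### Second moments -/

theorem integrable_norm_sq_of_mem_momentFiber {G : SymMat N}
    {μ : Measure (EuclideanSpace ℝ (Fin N))} (hμ : μ ∈ momentFiber G) :
    Integrable (fun x => ‖x‖ ^ 2) μ :=
  hμ.2.1.integrable_norm_pow (by norm_num)

theorem integrable_coord_mul {μ : Measure (EuclideanSpace ℝ (Fin N))}
    (hμ : Integrable (fun x => ‖x‖ ^ 2) μ) (i j : Fin N) : Integrable (fun x => x i * x j) μ := by
  refine hμ.mono' (by fun_prop) (Eventually.of_forall fun x => ?_)
  rw [norm_mul, sq]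
  gcongr <;> exact PiLp.norm_apply_le x _

theorem integrable_quadForm_of_mem_momentFiber {G : SymMat N}
    {μ : Measure (EuclideanSpace ℝ (Fin N))} (hμ : μ ∈ momentFiber G) (A : SymMat N) :
    Integrable (quadForm A) μ := by
  simp only [funext (quadForm_eq_sum A)]
  exact integrable_finsetSum _ fun i _ => integrable_finsetSum _ fun j _ =>
    (integrable_coord_mul (integrable_norm_sq_of_mem_momentFiber hμ) i j).const_mul _

theorem integral_quadForm_of_mem_momentFiber {G : SymMat N}
    {μ : Measure (EuclideanSpace ℝ (Fin N))} (hμ : μ ∈ momentFiber G) (A : SymMat N) :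
    ∫ x, 1 / 2 * quadForm A x ∂μ = halfTrace A G := by
  have h := integrable_coord_mul (integrable_norm_sq_of_mem_momentFiber hμ)
  rw [integral_const_mul, halfTrace_eq_sum]
  congr 1
  simp only [quadForm_eq_sum]
  refine (integral_finsetSum _ fun i _ => integrable_finsetSum _ fun j _ =>
    (h i j).const_mul _).trans (Finset.sum_congr rfl fun i _ => ?_)
  refine (integral_finsetSum _ fun j _ => (h i j).const_mul _).trans
    (Finset.sum_congr rfl fun j _ => ?_)
  rw [integral_const_mul, hμ.2.2 i j]

theorem integral_neg_sub_sub_const {E : Type*} [MeasurableSpace E] {μ : Measure E}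
    [IsProbabilityMeasure μ] {f g : E → ℝ} (hf : Integrable f μ) (hg : Integrable g μ) (c : ℝ) :
    ∫ x, (-f x - g x - c) ∂μ = -∫ x, f x ∂μ - ∫ x, g x ∂μ - c := by
  have h : ∫ x, (-f x - g x - c) ∂μ = ∫ x, (-f x - g x) ∂μ - ∫ _, c ∂μ :=
    integral_sub (hf.neg.sub hg) (integrable_const c)
  have h2 : ∫ x, (-f x - g x) ∂μ = ∫ x, -f x ∂μ - ∫ x, g x ∂μ := integral_sub hf.neg hg
  rw [h, h2, integral_neg]
  simp

/-- The quadratic lower bound on U is integrable against finite second moments, so ∫U dμ is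
meaningful in (-∞, ∞]. -/
theorem lintegral_ofReal_neg_potential_ne_top (hU : WeakGrowth U) {G : SymMat N}
    {μ : Measure (EuclideanSpace ℝ (Fin N))} (hμ : μ ∈ momentFiber G) :
    ∫⁻ x, ENNReal.ofReal (-U x) ∂μ ≠ ⊤ := by
  obtain ⟨C, hC⟩ := hU.bound
  have := hμ.1
  have h : Integrable (fun x => C * (1 + ‖x‖ ^ 2)) μ :=
    ((integrable_const 1).add (integrable_norm_sq_of_mem_momentFiber hμ)).const_mul C
  refine (lt_of_le_of_lt (lintegral_mono fun x => ?_) h.lintegral_lt_top).ne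
  exact ENNReal.ofReal_le_ofReal (by linarith [hC x])

/-! ### Weak duality -/

/-- Pointwise form of Gibbs' inequality: log t ≤ t - 1 at t = b/a. -/
theorem one_sub_div_le_log {a b : ℝ} (ha : 0 < a) (hb : 0 < b) :
    Real.log b + 1 - b / a ≤ Real.log a := by
  have := Real.log_le_sub_one_of_pos (div_pos hb ha)
  rw [Real.log_div hb.ne' ha.ne'] at this
  linarith

/-- **Gibbs' inequality** for real-valued quantities: relative to a density `p` of mass one, the
entropy is at most the cross entropy. -/
theorem entropy_le_of_density {μ : Measure (EuclideanSpace ℝ (Fin N))} [IsProbabilityMeasure μ]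
    (hac : μ ≪ volume) {p : EuclideanSpace ℝ (Fin N) → ℝ} (hp : ∀ x, 0 < p x) (hpm : Measurable p)
    (hp1 : ∫⁻ x, ENNReal.ofReal (p x) ≤ 1) (hlog : Integrable (fun x => Real.log (p x)) μ) :
    entropy μ ≤ ((-∫ x, Real.log (p x) ∂μ : ℝ) : EReal) := by
  set f : EuclideanSpace ℝ (Fin N) → ℝ := fun x => (μ.rnDeriv volume x).toReal with hf
  have hfm : Measurable f := (Measure.measurable_rnDeriv μ volume).ennreal_toReal
  have hfpos : ∀ᵐ x ∂μ, 0 < f x := by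
    filter_upwards [Measure.rnDeriv_pos hac, hac.ae_le (Measure.rnDeriv_lt_top μ volume)]
      with x h1 h2 using ENNReal.toReal_pos h1.ne' h2.ne
  have hpfm : Measurable fun x => p x / f x := hpm.div hfm
  -- Integrating p/f against dμ = f dx recovers the mass of p where f is nonzero.
  have hlint : ∫⁻ x, ENNReal.ofReal (p x / f x) ∂μ ≤ 1 := by
    rw [← lintegral_rnDeriv_mul hac hpfm.ennreal_ofReal.aemeasurable]
    refine (lintegral_mono_ae ?_).trans hp1
    filter_upwards [Measure.rnDeriv_lt_top μ volume] with x hx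
    rw [← ENNReal.ofReal_toReal hx.ne, ← ENNReal.ofReal_mul ENNReal.toReal_nonneg]
    apply ENNReal.ofReal_le_ofReal
    change f x * (p x / f x) ≤ p x
    rcases eq_or_ne (f x) 0 with h0 | h0
    · simp [h0, (hp x).le]
    · rw [mul_div_cancel₀ _ h0]
  have hpf : Integrable (fun x => p x / f x) μ := by
    refine (lintegral_ofReal_ne_top_iff_integrable hpfm.aestronglyMeasurable
      (Eventually.of_forall fun x => div_nonneg (hp x).le ENNReal.toReal_nonneg)).1 ?_
    exact (hlint.trans_lt ENNReal.one_lt_top).ne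
  have hpf1 : ∫ x, p x / f x ∂μ ≤ 1 := by
    rw [integral_eq_lintegral_of_nonneg_ae (Eventually.of_forall fun x =>
      div_nonneg (hp x).le ENNReal.toReal_nonneg) hpf.1]
    exact ENNReal.toReal_le_of_le_ofReal zero_le_one (by simpa using hlint)
  have hlog1 : Integrable (fun x => Real.log (p x) + 1) μ := hlog.add (integrable_const 1)
  have hlow : Integrable (fun x => Real.log (p x) + 1 - p x / f x) μ :=
    hlog1.sub hpf
  have hle : ∀ᵐ x ∂μ, Real.log (p x) + 1 - p x / f x ≤ Real.log (f x) := by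
    filter_upwards [hfpos] with x hx using one_sub_div_le_log hx (hp x)
  -- The integrable minorant of log f shows that the entropy integral is either finite or +∞, never
  -- an indeterminate difference.
  have hneg : ∫⁻ x, ENNReal.ofReal (-Real.log (f x)) ∂μ ≠ ⊤ := by
    refine (lt_of_le_of_lt (lintegral_mono_ae ?_) hlow.neg.lintegral_lt_top).ne
    filter_upwards [hle] with x hx
    exact ENNReal.ofReal_le_ofReal (neg_le_neg hx)
  rw [entropy, if_pos hac]
  change -extIntegral μ (fun x => Real.log (f x)) ≤ _
  rcases integrable_or_extIntegral_eq_top (f := fun x => Real.log (f x))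
    (Real.measurable_log.comp hfm).aestronglyMeasurable hneg
    with hi | ht
  · rw [extIntegral_of_integrable hi, ← EReal.coe_neg, EReal.coe_le_coe_iff, neg_le_neg_iff]
    calc ∫ x, Real.log (p x) ∂μ ≤ ∫ x, Real.log (p x) + 1 - p x / f x ∂μ := by
          rw [integral_sub hlog1 hpf,
            integral_add hlog (integrable_const 1)]
          simp
          linarith
      _ ≤ ∫ x, Real.log (f x) ∂μ := integral_mono_ae hlow hi hle
  · rw [ht]
    simp

theorem log_gibbsWeight_div (hU : Measurable U) {A : SymMat N} (hA : A ∈ effDom (freeEnergy U))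
    (x : EuclideanSpace ℝ (Fin N)) :
    Real.log (gibbsWeight U A x / realPartition U A) =
      -(1 / 2 * quadForm A x) - U x - Real.log (realPartition U A) := by
  rw [Real.log_div (gibbsWeight_pos A x).ne' (realPartition_pos hU hA).ne', gibbsWeight,
    Real.log_exp]
  ring

/-- Gibbs' inequality against the normalised weight at A. The cases ∫U dμ = ∞ and μ not absolutely
continuous are harmless, as the left side is then -∞. -/
theorem entropy_sub_le (hU : WeakGrowth U) {A G : SymMat N} (hA : A ∈ effDom (freeEnergy U))
    {μ : Measure (EuclideanSpace ℝ (Fin N))} (hμ : μ ∈ momentFiber G) :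
    entropy μ - extIntegral μ U ≤
      ((halfTrace A G + Real.log (realPartition U A) : ℝ) : EReal) := by
  have := hμ.1
  rcases integrable_or_extIntegral_eq_top hU.measurable.aestronglyMeasurable
    (lintegral_ofReal_neg_potential_ne_top hU hμ) with hi | ht
  swap
  · rw [ht, EReal.sub_top]; exact bot_le
  by_cases hac : μ ≪ volume
  swap
  · rw [entropy, if_neg hac, EReal.bot_sub]; exact bot_le
  have hq : Integrable (fun x => 1 / 2 * quadForm A x) μ :=
    (integrable_quadForm_of_mem_momentFiber hμ A).const_mul _
  have hZ := realPartition_pos hU.measurable hA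
  have hlog := log_gibbsWeight_div hU.measurable hA
  have hint : Integrable (fun x => -(1 / 2 * quadForm A x) - U x -
      Real.log (realPartition U A)) μ := (hq.neg.sub hi).sub (integrable_const _)
  have key := entropy_le_of_density hac (p := fun x => gibbsWeight U A x / realPartition U A)
    (fun x => div_pos (gibbsWeight_pos A x) hZ)
    ((measurable_gibbsWeight hU.measurable A).div_const _) ?_ (by simpa only [hlog] using hint)
  · simp only [hlog] at key
    rw [integral_neg_sub_sub_const hq hi, integral_quadForm_of_mem_momentFiber hμ] at key
    rw [extIntegral_of_integrable hi]
    refine (EReal.sub_le_sub key le_rfl).trans ?_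
    rw [← EReal.coe_sub, EReal.coe_le_coe_iff]
    linarith
  · simp only [div_eq_mul_inv]
    rw [← ofReal_integral_eq_lintegral_ofReal
      (((mem_effDom_iff_integrable hU.measurable).1 hA).mul_const _)
      (Eventually.of_forall fun x => mul_nonneg (gibbsWeight_pos A x).le (inv_nonneg.2 hZ.le)),
      integral_mul_const]
    change ENNReal.ofReal (realPartition U A * _) ≤ 1
    rw [mul_inv_cancel₀ hZ.ne', ENNReal.ofReal_one]

theorem dualFn_le (hU : WeakGrowth U) {A : SymMat N} (hA : A ∈ effDom (freeEnergy U))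
    (G : SymMat N) :
    dualFn U G ≤ ((halfTrace A G + Real.log (realPartition U A) : ℝ) : EReal) :=
  iSup₂_le fun _ hμ => entropy_sub_le hU hA hμ

theorem dualFn_ne_top (hU : WeakGrowth U) (G : SymMat N) : dualFn U G ≠ ⊤ := by
  obtain ⟨A, hA⟩ := exists_mem_effDom hU
  exact ((dualFn_le hU hA G).trans_lt (EReal.coe_lt_top _)).ne

/-! ### Gibbs measures restricted to a set -/

/-- The probability measure with density proportional to the Gibbs weight on `K`. -/
noncomputable def gibbsMeasure (U : EuclideanSpace ℝ (Fin N) → ℝ) (A : SymMat N)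
    (K : Set (EuclideanSpace ℝ (Fin N))) : Measure (EuclideanSpace ℝ (Fin N)) :=
  (volume.restrict K).withDensity fun x =>
    ENNReal.ofReal (gibbsWeight U A x / ∫ y in K, gibbsWeight U A y)

/-- The second moments of `gibbsMeasure`. -/
noncomputable def gibbsSecondMoment (U : EuclideanSpace ℝ (Fin N) → ℝ) (A : SymMat N)
    (K : Set (EuclideanSpace ℝ (Fin N))) : SymMat N :=
  ⟨Matrix.of fun i j => (∫ y in K, gibbsWeight U A y)⁻¹ * ∫ x in K, gibbsWeight U A x * (x i * x j),
    by
      change Matrix.IsSymm _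
      ext i j
      simp [mul_comm]⟩

section GibbsMeasure

variable {A : SymMat N} {K : Set (EuclideanSpace ℝ (Fin N))}

theorem integrable_gibbsMeasure_iff (hU : Measurable U) (hz : 0 < ∫ y in K, gibbsWeight U A y)
    {g : EuclideanSpace ℝ (Fin N) → ℝ} :
    Integrable g (gibbsMeasure U A K) ↔ IntegrableOn (fun x => gibbsWeight U A x * g x) K := by
  rw [gibbsMeasure, integrable_withDensity_iff_integrable_smul'
    ((measurable_gibbsWeight hU A).div_const _).ennreal_ofReal (by simp), IntegrableOn]
  have : (fun x => (ENNReal.ofReal (gibbsWeight U A x / ∫ y in K, gibbsWeight U A y)).toReal • g x) =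
      fun x => (∫ y in K, gibbsWeight U A y)⁻¹ * (gibbsWeight U A x * g x) := by
    ext x
    rw [ENNReal.toReal_ofReal (div_nonneg (gibbsWeight_pos A x).le hz.le), smul_eq_mul]
    ring
  rw [this, integrable_const_mul_iff (IsUnit.mk0 _ (inv_ne_zero hz.ne'))]

theorem integral_gibbsMeasure (hU : Measurable U) (hz : 0 < ∫ y in K, gibbsWeight U A y)
    (g : EuclideanSpace ℝ (Fin N) → ℝ) :
    ∫ x, g x ∂gibbsMeasure U A K =
      (∫ y in K, gibbsWeight U A y)⁻¹ * ∫ x in K, gibbsWeight U A x * g x := by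
  rw [gibbsMeasure, integral_withDensity_eq_integral_toReal_smul
    ((measurable_gibbsWeight hU A).div_const _).ennreal_ofReal (by simp), ← integral_const_mul]
  congr 1
  ext x
  rw [ENNReal.toReal_ofReal (div_nonneg (gibbsWeight_pos A x).le hz.le), smul_eq_mul]
  ring

theorem integrableOn_gibbsWeight_of_pos (hz : 0 < ∫ y in K, gibbsWeight U A y) :
    IntegrableOn (gibbsWeight U A) K := by
  by_contra h
  rw [integral_undef h] at hz
  exact lt_irrefl _ hz

theorem gibbsMeasure_mem_momentFiber (hU : Measurable U) (hz : 0 < ∫ y in K, gibbsWeight U A y)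
    (h2 : IntegrableOn (fun x => gibbsWeight U A x * ‖x‖ ^ 2) K) :
    gibbsMeasure U A K ∈ momentFiber (gibbsSecondMoment U A K) := by
  refine ⟨⟨?_⟩, ?_, fun i j => integral_gibbsMeasure hU hz _⟩
  · rw [gibbsMeasure, withDensity_apply _ MeasurableSet.univ, Measure.restrict_univ,
      ← ofReal_integral_eq_lintegral_ofReal ((integrableOn_gibbsWeight_of_pos hz).div_const _)
        (Eventually.of_forall fun x => div_nonneg (gibbsWeight_pos A x).le hz.le),
      integral_div, div_self hz.ne', ENNReal.ofReal_one]
  · rw [memLp_two_iff_integrable_sq_norm aestronglyMeasurable_id]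
    exact (integrable_gibbsMeasure_iff hU hz).2 h2

theorem gibbsMeasure_absolutelyContinuous : gibbsMeasure U A K ≪ volume :=
  (withDensity_absolutelyContinuous _ _).trans Measure.restrict_le_self.absolutelyContinuous

/-- The Gibbs measure attains equality in the variational inequality. -/
theorem entropy_gibbsMeasure_sub (hU : Measurable U) (hK : MeasurableSet K)
    (hz : 0 < ∫ y in K, gibbsWeight U A y)
    (h2 : IntegrableOn (fun x => gibbsWeight U A x * ‖x‖ ^ 2) K)
    (hUi : IntegrableOn (fun x => gibbsWeight U A x * U x) K) :
    entropy (gibbsMeasure U A K) - extIntegral (gibbsMeasure U A K) U =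
      ((halfTrace A (gibbsSecondMoment U A K) + Real.log (∫ y in K, gibbsWeight U A y) : ℝ) :
        EReal) := by
  set z := ∫ y in K, gibbsWeight U A y with hzdef
  set μ := gibbsMeasure U A K with hμdef
  have hfib : μ ∈ momentFiber (gibbsSecondMoment U A K) := gibbsMeasure_mem_momentFiber hU hz h2
  have := hfib.1
  have hi : Integrable U μ := (integrable_gibbsMeasure_iff hU hz).2 hUi
  have hq : Integrable (fun x => 1 / 2 * quadForm A x) μ :=
    (integrable_quadForm_of_mem_momentFiber hfib A).const_mul _
  have hm : Measurable fun x => ENNReal.ofReal (gibbsWeight U A x / z) :=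
    ((measurable_gibbsWeight hU A).div_const _).ennreal_ofReal
  have hrn : μ.rnDeriv volume =ᵐ[volume]
      K.indicator fun x => ENNReal.ofReal (gibbsWeight U A x / z) := by
    rw [hμdef, gibbsMeasure, ← withDensity_indicator hK]
    exact Measure.rnDeriv_withDensity _ (hm.indicator hK)
  -- The density vanishes off K, so the formula for its logarithm is available only on K; that
  -- suffices because K carries μ.
  have hKμ : ∀ᵐ x ∂μ, x ∈ K :=
    (withDensity_absolutelyContinuous _ _).ae_le (ae_restrict_mem hK)
  have hlog : (fun x => Real.log (μ.rnDeriv volume x).toReal) =ᵐ[μ]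
      fun x => -(1 / 2 * quadForm A x) - U x - Real.log z := by
    filter_upwards [gibbsMeasure_absolutelyContinuous.ae_le hrn, hKμ] with x hx hxK
    rw [hx, Set.indicator_of_mem hxK,
      ENNReal.toReal_ofReal (div_nonneg (gibbsWeight_pos A x).le hz.le),
      Real.log_div (gibbsWeight_pos A x).ne' hz.ne', gibbsWeight, Real.log_exp]
    ring
  have hint : Integrable (fun x => -(1 / 2 * quadForm A x) - U x - Real.log z) μ :=
    (hq.neg.sub hi).sub (integrable_const _)
  rw [entropy, if_pos gibbsMeasure_absolutelyContinuous,
    extIntegral_of_integrable (hint.congr hlog.symm), extIntegral_of_integrable hi,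
    integral_congr_ae hlog, integral_neg_sub_sub_const hq hi, integral_quadForm_of_mem_momentFiber hfib,
    ← EReal.coe_neg, ← EReal.coe_sub, EReal.coe_eq_coe_iff]
  simp
  ring

theorem le_dualFn_gibbsSecondMoment (hU : Measurable U) (hK : MeasurableSet K)
    (hz : 0 < ∫ y in K, gibbsWeight U A y)
    (h2 : IntegrableOn (fun x => gibbsWeight U A x * ‖x‖ ^ 2) K)
    (hUi : IntegrableOn (fun x => gibbsWeight U A x * U x) K) :
    ((halfTrace A (gibbsSecondMoment U A K) + Real.log (∫ y in K, gibbsWeight U A y) : ℝ) :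
        EReal) ≤ dualFn U (gibbsSecondMoment U A K) := by
  rw [← entropy_gibbsMeasure_sub hU hK hz h2 hUi]
  exact le_iSup₂ (f := fun μ (_ : μ ∈ momentFiber (gibbsSecondMoment U A K)) =>
    entropy μ - extIntegral μ U) _ (gibbsMeasure_mem_momentFiber hU hz h2)

end GibbsMeasure

/-! ### The variational formula for the free energy -/

/-- Pairing G with vvᵀ turns the matrix of second moments into the second moment of the single
variable v·x. -/
theorem quadForm_eq_integral {G : SymMat N} {μ : Measure (EuclideanSpace ℝ (Fin N))}
    (hμ : μ ∈ momentFiber G) (v : EuclideanSpace ℝ (Fin N)) :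
    quadForm G v = ∫ x, (∑ i, v i * x i) ^ 2 ∂μ := by
  have h := integral_quadForm_of_mem_momentFiber hμ (symRankOne v)
  rw [integral_const_mul, halfTrace_symRankOne] at h
  simp only [quadForm_symRankOne] at h
  linarith

theorem mem_posSemidefCone_of_mem_momentFiber {G : SymMat N}
    {μ : Measure (EuclideanSpace ℝ (Fin N))} (hμ : μ ∈ momentFiber G) : G ∈ posSemidefCone N :=
  mem_posSemidefCone.2 fun v => by
    rw [quadForm_eq_integral hμ]
    exact integral_nonneg fun x => sq_nonneg _

/-- The bounded sets on which both the argument and the potential are bounded by `n`. -/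
def truncation (U : EuclideanSpace ℝ (Fin N) → ℝ) (n : ℕ) : Set (EuclideanSpace ℝ (Fin N)) :=
  {x | ‖x‖ ≤ n ∧ |U x| ≤ n}

theorem measurableSet_truncation (hU : Measurable U) (n : ℕ) : MeasurableSet (truncation U n) :=
  (measurableSet_le measurable_norm measurable_const).inter
    (measurableSet_le (continuous_abs.measurable.comp hU) measurable_const)

theorem monotone_truncation : Monotone (truncation U) := fun _ _ hmn _ hx =>
  ⟨hx.1.trans (Nat.cast_le.2 hmn), hx.2.trans (Nat.cast_le.2 hmn)⟩

theorem iUnion_truncation : ⋃ n, truncation U n = Set.univ := by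
  refine Set.eq_univ_of_forall fun x => Set.mem_iUnion.2 ?_
  obtain ⟨n, hn⟩ := exists_nat_ge (max ‖x‖ |U x|)
  exact ⟨n, (le_max_left _ _).trans hn, (le_max_right _ _).trans hn⟩

/-- On the truncated set the exponent is bounded and the volume is finite, so A need not lie in the
effective domain. -/
theorem integrableOn_truncation (hU : Measurable U) (A : SymMat N) (n : ℕ)
    {g : EuclideanSpace ℝ (Fin N) → ℝ} (hg : Measurable g) {M : ℝ}
    (hM : ∀ x ∈ truncation U n, |g x| ≤ M) :
    IntegrableOn (fun x => gibbsWeight U A x * g x) (truncation U n) := by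
  have hsub : truncation U n ⊆ Metric.closedBall 0 n := fun x hx => by simpa using hx.1
  refine Measure.integrableOn_of_bounded
    (M := Real.exp ((N : ℝ) ^ 2 * ‖A‖ * (n : ℝ) ^ 2 + n) * M)
    ((measure_mono hsub).trans_lt measure_closedBall_lt_top).ne
    ((measurable_gibbsWeight hU A).mul hg).aestronglyMeasurable ?_
  filter_upwards [ae_restrict_mem (measurableSet_truncation hU n)] with x hx
  rw [norm_mul, Real.norm_of_nonneg (gibbsWeight_pos A x).le, Real.norm_eq_abs]
  refine mul_le_mul ?_ (hM x hx) (abs_nonneg _) (Real.exp_pos _).le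
  rw [gibbsWeight, Real.exp_le_exp]
  have h1 : |quadForm A x| ≤ (N : ℝ) ^ 2 * ‖A‖ * (n : ℝ) ^ 2 :=
    (abs_quadForm_le A x).trans (by gcongr; exact hx.1)
  have h2 := abs_le.1 h1
  have h3 := abs_le.1 hx.2
  have h4 : 0 ≤ (N : ℝ) ^ 2 * ‖A‖ * (n : ℝ) ^ 2 := by positivity
  linarith

theorem freeEnergy_le_halfTrace_sub (hU : WeakGrowth U) (A G : SymMat N) :
    freeEnergy U A ≤ ((halfTrace A G : ℝ) : EReal) - dualFn U G := by
  by_cases hA : A ∈ effDom (freeEnergy U)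
  · refine le_trans (le_of_eq ?_) (EReal.sub_le_sub le_rfl (dualFn_le hU hA G))
    rw [freeEnergy_eq_coe hU.measurable hA, ← EReal.coe_sub]
    congr 1
    ring
  · have : freeEnergy U A = ⊥ := by simpa [effDom] using hA
    rw [this]
    exact bot_le

/-- The second moment of the Gibbs measure on the truncated set is an admissible competitor; by the
equality case its value is at most minus the logarithm of the truncated partition function. -/
theorem iInf_le_neg_log_truncation (hU : WeakGrowth U) (A : SymMat N) (n : ℕ) :
    ⨅ G ∈ posSemidefCone N, ((halfTrace A G : ℝ) : EReal) - dualFn U G ≤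
      -ENNReal.log (∫⁻ x in truncation U n, ENNReal.ofReal (gibbsWeight U A x)) := by
  have hm := hU.measurable
  have hint : IntegrableOn (gibbsWeight U A) (truncation U n) := by
    simpa using integrableOn_truncation hm A n measurable_const (g := fun _ => 1) (M := 1) (by simp)
  rw [← ofReal_integral_eq_lintegral_ofReal hint
    (Eventually.of_forall fun x => (gibbsWeight_pos A x).le)]
  rcases (integral_nonneg fun x => (gibbsWeight_pos (U := U) A x).le :
    0 ≤ ∫ x in truncation U n, gibbsWeight U A x).eq_or_lt with hz | hz
  -- A truncated set of zero mass yields the trivial bound -log 0 = +∞.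
  · simp [← hz]
  have h2 := integrableOn_truncation hm A n (measurable_norm.pow_const 2) (M := (n : ℝ) ^ 2)
    fun x hx => by rw [abs_of_nonneg (sq_nonneg _)]; gcongr; exact hx.1
  have hUi := integrableOn_truncation hm A n hm (M := n) fun x hx => hx.2
  have hle := le_dualFn_gibbsSecondMoment hm (measurableSet_truncation hm n) hz h2 hUi
  refine (iInf₂_le (gibbsSecondMoment U A (truncation U n))
    (mem_posSemidefCone_of_mem_momentFiber (gibbsMeasure_mem_momentFiber hm hz h2))).trans ?_
  refine (EReal.sub_le_sub le_rfl hle).trans (le_of_eq ?_)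
  rw [ENNReal.log_ofReal_of_pos hz, ← EReal.coe_sub, ← EReal.coe_neg]
  congr 1
  ring

theorem tendsto_lintegral_truncation (A : SymMat N) :
    Tendsto (fun n => ∫⁻ x in truncation U n, ENNReal.ofReal (gibbsWeight U A x)) atTop
      (𝓝 (partitionFn U A)) := by
  have h := setLIntegral_iUnion_of_directed (μ := volume)
    (fun x => ENNReal.ofReal (gibbsWeight U A x))
    (monotone_truncation (U := U)).directed_le
  rw [iUnion_truncation, setLIntegral_univ] at h
  rw [partitionFn_eq_lintegral, h]
  exact tendsto_atTop_iSup fun m n hmn => lintegral_mono_set (monotone_truncation hmn)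

/-- **Variational formula** for the free energy. -/
theorem freeEnergy_eq_iInf (hU : WeakGrowth U) (A : SymMat N) :
    freeEnergy U A = ⨅ G ∈ posSemidefCone N, ((halfTrace A G : ℝ) : EReal) - dualFn U G := by
  refine le_antisymm (le_iInf₂ fun G _ => freeEnergy_le_halfTrace_sub hU A G) ?_
  have hlim := (continuous_neg.comp ENNReal.continuous_log).continuousAt.tendsto.comp
    (tendsto_lintegral_truncation (U := U) A)
  exact ge_of_tendsto' hlim fun n => iInf_le_neg_log_truncation hU A n

/-! ### The moment fibers -/

/-- A centred Gaussian has second moments equal to its covariance, and singular covariances are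
allowed, so the whole semidefinite cone is reached. -/
theorem multivariateGaussian_mem_momentFiber {G : SymMat N} (hG : G ∈ posSemidefCone N) :
    ProbabilityTheory.multivariateGaussian 0 (G : Matrix (Fin N) (Fin N) ℝ) ∈ momentFiber G := by
  set μ := ProbabilityTheory.multivariateGaussian 0 (G : Matrix (Fin N) (Fin N) ℝ)
  have h2 : MemLp id 2 μ := ProbabilityTheory.IsGaussian.memLp_two_id
  refine ⟨inferInstance, h2, fun i j => ?_⟩
  have hcov := ProbabilityTheory.covariance_eval_multivariateGaussian (μ := 0) hG i j
  have hmean : ∀ k : Fin N, ∫ x, x k ∂μ = 0 := fun k => by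
    have hi : Integrable id μ := h2.integrable (by norm_num)
    have h := ContinuousLinearMap.integral_comp_comm
      (EuclideanSpace.proj k : EuclideanSpace ℝ (Fin N) →L[ℝ] ℝ) hi
    simp only [id, μ, ProbabilityTheory.integral_id_multivariateGaussian] at h
    simpa using h
  have hmem : ∀ k : Fin N, MemLp (fun x : EuclideanSpace ℝ (Fin N) => x k) 2 μ := fun k =>
    (EuclideanSpace.proj k : EuclideanSpace ℝ (Fin N) →L[ℝ] ℝ).comp_memLp' h2
  rw [ProbabilityTheory.covariance_eq_sub (hmem i) (hmem j)] at hcov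
  change _ - (∫ x, x i ∂μ) * (∫ x, x j ∂μ) = _ at hcov
  rw [hmean, zero_mul, sub_zero] at hcov
  exact hcov

theorem momentFiber_eq_empty_iff (G : SymMat N) : momentFiber G = ∅ ↔ G ∉ posSemidefCone N := by
  refine ⟨fun h hG => ?_, fun h => ?_⟩
  · exact h.subset (multivariateGaussian_mem_momentFiber hG)
  · exact Set.eq_empty_of_forall_notMem fun μ hμ => h (mem_posSemidefCone_of_mem_momentFiber hμ)

/-! ### Degenerate second moments -/

theorem volume_hyperplane {v : EuclideanSpace ℝ (Fin N)} (hv : v ≠ 0) :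
    volume {x : EuclideanSpace ℝ (Fin N) | ∑ i, v i * x i = 0} = 0 := by
  have hsum : ∀ x : EuclideanSpace ℝ (Fin N), inner ℝ v x = ∑ i, v i * x i := fun x => by
    simp [PiLp.inner_apply, mul_comm]
  have h := Measure.addHaar_submodule volume (LinearMap.ker (innerₛₗ ℝ v)) fun htop => by
    have hmem : v ∈ LinearMap.ker (innerₛₗ ℝ v) := htop ▸ Submodule.mem_top
    simp [hv] at hmem
  refine Eq.trans (congrArg _ ?_) h
  ext x
  simp [← hsum]

theorem exists_quadForm_nonpos {G : SymMat N} (hG : G ∉ posDefCone N) :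
    ∃ v, v ≠ 0 ∧ quadForm G v ≤ 0 := by
  by_contra! h
  exact hG (mem_posDefCone.2 h)

/-- A nonzero v with vᵀGv ≤ 0 forces ∫(v·x)² dμ = 0, so μ is carried by the hyperplane orthogonal to
v, which is Lebesgue null. -/
theorem not_absolutelyContinuous {G : SymMat N} (hG : G ∉ posDefCone N)
    {μ : Measure (EuclideanSpace ℝ (Fin N))} (hμ : μ ∈ momentFiber G) : ¬ μ ≪ volume := by
  intro hac
  have := hμ.1
  obtain ⟨v, hv, hGv⟩ := exists_quadForm_nonpos hG
  rw [quadForm_eq_integral hμ] at hGv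
  have hint : Integrable (fun x => (∑ i, v i * x i) ^ 2) μ := by
    simpa only [← quadForm_symRankOne] using
      integrable_quadForm_of_mem_momentFiber hμ (symRankOne v)
  have h0 : ∫ x, (∑ i, v i * x i) ^ 2 ∂μ = 0 :=
    le_antisymm hGv (integral_nonneg fun x => sq_nonneg _)
  rw [integral_eq_zero_iff_of_nonneg (fun x => sq_nonneg _) hint] at h0
  have h1 : ∀ᵐ x ∂μ, ¬ ∑ i, v i * x i = 0 := hac.ae_le (measure_eq_zero_iff_ae_notMem.1
    (volume_hyperplane hv))
  have h2 : ∀ᵐ _ ∂μ, False := by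
    filter_upwards [h0, h1] with x hx hx'
    exact hx' (by simpa using hx)
  simp only [eventually_false_iff_eq_bot, ae_eq_bot] at h2
  exact IsProbabilityMeasure.ne_zero μ h2

theorem dualFn_eq_bot {G : SymMat N} (hG : G ∉ posDefCone N) : dualFn U G = ⊥ := by
  refine le_bot_iff.1 (iSup₂_le fun μ hμ => ?_)
  rw [entropy, if_neg (not_absolutelyContinuous hG hμ), EReal.bot_sub]

/-- Adding n·vvᵀ multiplies the weight by exp(-n(v·x)²/2), which tends to 0 off a null hyperplane
while the weight at A dominates. -/
theorem tendsto_realPartition_add_rankOne (hU : Measurable U) {A : SymMat N}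
    (hA : A ∈ effDom (freeEnergy U)) {v : EuclideanSpace ℝ (Fin N)} (hv : v ≠ 0) :
    (∀ n : ℕ, A + (n : ℝ) • symRankOne v ∈ effDom (freeEnergy U)) ∧
      Tendsto (fun n : ℕ => realPartition U (A + (n : ℝ) • symRankOne v)) atTop (𝓝 0) := by
  have hint := (mem_effDom_iff_integrable hU).1 hA
  have hW : ∀ (n : ℕ) x, gibbsWeight U (A + (n : ℝ) • symRankOne v) x =
      gibbsWeight U A x * Real.exp (-(n * (1 / 2 * (∑ i, v i * x i) ^ 2))) := fun n x => by
    rw [gibbsWeight, gibbsWeight, ← Real.exp_add, quadForm_add, quadForm_smul, quadForm_symRankOne]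
    ring_nf
  have hle : ∀ (n : ℕ) x, ‖gibbsWeight U (A + (n : ℝ) • symRankOne v) x‖ ≤ gibbsWeight U A x :=
    fun n x => by
      rw [Real.norm_of_nonneg (gibbsWeight_pos _ x).le, hW]
      refine mul_le_of_le_one_right (gibbsWeight_pos A x).le (Real.exp_le_one_iff.2 ?_)
      rw [neg_nonpos]
      positivity
  refine ⟨fun n => (mem_effDom_iff_integrable hU).2 (hint.mono'
    (measurable_gibbsWeight hU _).aestronglyMeasurable (Eventually.of_forall (hle n))), ?_⟩
  have h := tendsto_integral_of_dominated_convergence (f := fun _ => (0 : ℝ)) (gibbsWeight U A)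
    (fun n : ℕ => (measurable_gibbsWeight hU
      (A + (n : ℝ) • symRankOne v)).aestronglyMeasurable (μ := volume)) hint
    (fun n => Eventually.of_forall (hle n)) ?_
  · rwa [integral_zero] at h
  · filter_upwards [measure_eq_zero_iff_ae_notMem.1 (volume_hyperplane hv)] with x hx
    have hpos : 0 < 1 / 2 * (∑ i, v i * x i) ^ 2 := by
      have : (∑ i, v i * x i) ≠ 0 := hx
      positivity
    simp only [hW]
    rw [← mul_zero (gibbsWeight U A x)]
    refine Tendsto.const_mul _ (Real.tendsto_exp_neg_atTop_nhds_zero.comp ?_)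
    exact tendsto_natCast_atTop_atTop.atTop_mul_const hpos

theorem concaveConj_le (hU : Measurable U) {A : SymMat N} (hA : A ∈ effDom (freeEnergy U))
    (G : SymMat N) : concaveConj (freeEnergy U) G ≤
      ((halfTrace A G + Real.log (realPartition U A) : ℝ) : EReal) := by
  refine (iInf_le _ A).trans (le_of_eq ?_)
  rw [freeEnergy_eq_coe hU hA, ← EReal.coe_sub, sub_neg_eq_add]

/-- Along A + n·vvᵀ with vᵀGv ≤ 0 the trace term does not increase, while log Z tends to -∞. -/
theorem concaveConj_eq_bot (hU : WeakGrowth U) {G : SymMat N} (hG : G ∉ posDefCone N) :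
    concaveConj (freeEnergy U) G = ⊥ := by
  obtain ⟨v, hv, hGv⟩ := exists_quadForm_nonpos hG
  obtain ⟨A, hA⟩ := exists_mem_effDom hU
  obtain ⟨hmem, hlim⟩ := tendsto_realPartition_add_rankOne hU.measurable hA hv
  have hlog : Tendsto (fun n : ℕ => Real.log (realPartition U (A + (n : ℝ) • symRankOne v)))
      atTop atBot :=
    Real.tendsto_log_nhdsGT_zero.comp (tendsto_nhdsWithin_iff.2 ⟨hlim,
      Eventually.of_forall fun n => realPartition_pos hU.measurable (hmem n)⟩)
  rw [EReal.eq_bot_iff_forall_lt]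
  intro y
  obtain ⟨n, hn⟩ := (hlog.eventually (eventually_lt_atBot (y - halfTrace A G))).exists
  refine (concaveConj_le hU.measurable (hmem n) G).trans_lt (EReal.coe_lt_coe_iff.2 ?_)
  rw [halfTrace_add_left, halfTrace_smul_left, halfTrace_symRankOne]
  have : (n : ℝ) * (1 / 2 * quadForm G v) ≤ 0 :=
    mul_nonpos_of_nonneg_of_nonpos (Nat.cast_nonneg n) (by linarith)
  linarith

/-! ### Coercivity of the dual functional -/

theorem exists_pos_le_quadForm {G : SymMat N} (hG : G ∈ posDefCone N) :
    ∃ ε > 0, ∀ x, ε * ‖x‖ ^ 2 ≤ quadForm G x := by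
  rcases (Metric.sphere (0 : EuclideanSpace ℝ (Fin N)) 1).eq_empty_or_nonempty with he | hne
  -- An empty unit sphere means that 0 is the only vector, so any ε works.
  · refine ⟨1, one_pos, fun x => ?_⟩
    have : x = 0 := by
      by_contra hx
      exact he.subset (show ‖x‖⁻¹ • x ∈ Metric.sphere (0 : EuclideanSpace ℝ (Fin N)) 1 by
        simp [norm_smul, hx])
    simp [this]
  · obtain ⟨y, hy, hmin⟩ := (isCompact_sphere (0 : EuclideanSpace ℝ (Fin N)) 1).exists_isMinOn hne
      (continuous_quadForm G).continuousOn
    have hy0 : y ≠ 0 := by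
      rintro rfl
      simp at hy
    refine ⟨quadForm G y, mem_posDefCone.1 hG y hy0, fun x => ?_⟩
    rcases eq_or_ne x 0 with rfl | hx
    · simp
    have h := hmin (show ‖x‖⁻¹ • x ∈ Metric.sphere (0 : EuclideanSpace ℝ (Fin N)) 1 by
        simp [norm_smul, hx])
    simp only [Set.mem_ofPred_eq, quadForm_smul_vec] at h
    calc quadForm G y * ‖x‖ ^ 2 ≤ (‖x‖⁻¹ ^ 2 * quadForm G x) * ‖x‖ ^ 2 := by gcongr
      _ = quadForm G x := by
        have := norm_ne_zero_iff.2 hx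
        field_simp

/-- The pairing is the mean of ½xᵀAx under a Gaussian with covariance G. -/
theorem halfTrace_nonneg {A G : SymMat N} (hA : A ∈ posSemidefCone N) (hG : G ∈ posSemidefCone N) :
    0 ≤ halfTrace A G := by
  rw [← integral_quadForm_of_mem_momentFiber (multivariateGaussian_mem_momentFiber hG)]
  exact integral_nonneg fun x => mul_nonneg (by norm_num) (mem_posSemidefCone.1 hA x)

/-- Since G - εI is still semidefinite for small ε, the pairing is at least ½ε·Tr A, and a nonzero
semidefinite matrix has positive trace. -/
theorem halfTrace_pos {A G : SymMat N} (hA : A ∈ posSemidefCone N) (hA0 : A ≠ 0)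
    (hG : G ∈ posDefCone N) : 0 < halfTrace A G := by
  obtain ⟨ε, hε, hle⟩ := exists_pos_le_quadForm hG
  have h1 : 0 ≤ halfTrace A (G - ε • symOne N) := halfTrace_nonneg hA (mem_posSemidefCone.2
    fun x => by rw [quadForm_sub, quadForm_smul, quadForm_symOne]; linarith [hle x])
  have hpsd : (A : Matrix (Fin N) (Fin N) ℝ).PosSemidef := hA
  have h2 : 0 < (A : Matrix (Fin N) (Fin N) ℝ).trace :=
    lt_of_le_of_ne hpsd.trace_nonneg fun h => hA0 (Subtype.ext (hpsd.trace_eq_zero_iff.1 h.symm))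
  have h3 : halfTrace A (symOne N) = 1 / 2 * (A : Matrix (Fin N) (Fin N) ℝ).trace := by
    simp [halfTrace, symOne]
  have h4 : halfTrace A G = halfTrace A (G - ε • symOne N) + ε * halfTrace A (symOne N) := by
    rw [← halfTrace_smul_right, ← halfTrace_add_right, sub_add_cancel]
  rw [h4, h3]
  positivity

/-- Otherwise x = 0 gives ⟨B, G⟩ ≤ 0, while scaling x shows B to be semidefinite, against strict
positivity of the pairing. The resulting region is where the dual integrand blows up in direction B.
-/
theorem exists_halfQuadForm_lt_halfTrace {B G : SymMat N} (hB : B ≠ 0) (hG : G ∈ posDefCone N) :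
    ∃ x, 1 / 2 * quadForm B x < halfTrace B G := by
  by_contra! h
  have h0 : halfTrace B G ≤ 0 := by simpa using h 0
  have hB' : B ∈ posSemidefCone N := mem_posSemidefCone.2 fun x => by
    by_contra! hx
    have hx2 : 1 / 2 * quadForm B x < 0 := by linarith
    obtain ⟨t, ht⟩ := exists_nat_gt (halfTrace B G / (1 / 2 * quadForm B x))
    rw [div_lt_iff_of_neg hx2] at ht
    have h1 := h ((t + 1 : ℝ) • x)
    rw [quadForm_smul_vec] at h1
    have ht0 : (0 : ℝ) ≤ t := Nat.cast_nonneg t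
    nlinarith [mul_nonneg ht0 ht0]
  exact absurd (halfTrace_pos hB' hB hG) (not_lt.2 h0)

/-- The exponential of the dual functional `A ↦ ½ Tr[A G] - Ω[A]`. -/
noncomputable def expDual (U : EuclideanSpace ℝ (Fin N) → ℝ) (G A : SymMat N) : ℝ≥0∞ :=
  ∫⁻ x, ENNReal.ofReal (Real.exp (halfTrace A G - 1 / 2 * quadForm A x - U x))

theorem expDual_eq (hU : Measurable U) (G A : SymMat N) :
    expDual U G A = ENNReal.ofReal (Real.exp (halfTrace A G)) * partitionFn U A := by
  rw [partitionFn_eq_lintegral, ← lintegral_const_mul _ (measurable_gibbsWeight hU A).ennreal_ofReal]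
  refine lintegral_congr fun x => ?_
  rw [← ENNReal.ofReal_mul (Real.exp_pos _).le, gibbsWeight, ← Real.exp_add]
  ring_nf

theorem measurable_expDual_integrand (hU : Measurable U) (G A : SymMat N) :
    Measurable fun x => ENNReal.ofReal (Real.exp (halfTrace A G - 1 / 2 * quadForm A x - U x)) :=
  (Real.measurable_exp.comp
    ((((continuous_quadForm A).measurable.const_mul _).const_sub _).sub hU)).ennreal_ofReal

theorem continuous_halfTrace_left (G : SymMat N) : Continuous fun A => halfTrace A G :=
  (halfTraceCLM G).continuous

/-- Fatou's lemma for the nonnegative integrand. Working with the exponential in `ℝ≥0∞` includes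
limit points outside the effective domain. -/
theorem expDual_le_liminf (hU : Measurable U) (G : SymMat N) {A : SymMat N} {a : ℕ → SymMat N}
    (ha : Tendsto a atTop (𝓝 A)) :
    expDual U G A ≤ liminf (fun n => expDual U G (a n)) atTop := by
  refine le_trans (le_of_eq ?_) (lintegral_liminf_le fun n => measurable_expDual_integrand hU G (a n))
  refine lintegral_congr fun x => ?_
  have hc : Continuous fun A : SymMat N =>
      ENNReal.ofReal (Real.exp (halfTrace A G - 1 / 2 * quadForm A x - U x)) :=
    ENNReal.continuous_ofReal.comp (Real.continuous_exp.comp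
      (((continuous_halfTrace_left G).sub ((continuous_quadForm_left x).const_mul _)).sub
        continuous_const))
  exact ((hc.tendsto A).comp ha).liminf_eq.symm

/-- Sublevel sets of the dual functional are bounded. -/
theorem isBounded_expDual_sublevel (hU : Measurable U) {G : SymMat N} (hG : G ∈ posDefCone N)
    {M : ℝ≥0∞} (hM : M ≠ ⊤) : Bornology.IsBounded {A : SymMat N | expDual U G A ≤ M} := by
  by_contra hnb
  have hex : ∀ n : ℕ, ∃ A : SymMat N, expDual U G A ≤ M ∧ (n : ℝ) < ‖A‖ := by
    intro n
    by_contra! h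
    exact hnb ((Metric.isBounded_closedBall (x := (0 : SymMat N)) (r := n)).subset fun A hA => by
      simpa using h A hA)
  choose a haM han using hex
  have hapos : ∀ n, 0 < ‖a n‖ := fun n => (Nat.cast_nonneg n).trans_lt (han n)
  have hproper : ProperSpace (SymMat N) := FiniteDimensional.proper ℝ _
  -- An unbounded sequence in the sublevel set has, after normalisation, a limiting direction B on
  -- the unit sphere.
  obtain ⟨B, hB, φ, hφ, hlim⟩ := (isCompact_sphere (0 : SymMat N) 1).tendsto_subseq
    (x := fun n => ‖a n‖⁻¹ • a n) fun n => by
      rw [mem_sphere_zero_iff_norm, norm_smul, norm_inv, norm_norm, inv_mul_cancel₀ (hapos n).ne']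
  have hB0 : B ≠ 0 := by
    rintro rfl
    simp at hB
  have hnorm : Tendsto (fun n => ‖a (φ n)‖) atTop atTop :=
    tendsto_atTop_mono (fun n => (han (φ n)).le)
      (tendsto_natCast_atTop_atTop.comp hφ.tendsto_atTop)
  set O : Set (EuclideanSpace ℝ (Fin N)) := {x | 1 / 2 * quadForm B x < halfTrace B G} with hO
  have hOopen : IsOpen O := isOpen_lt ((continuous_quadForm B).const_mul _) continuous_const
  have hOpos : 0 < volume O :=
    hOopen.measure_pos _ (exists_halfQuadForm_lt_halfTrace hB0 hG)
  have hinf : ∀ x ∈ O, liminf (fun n => ENNReal.ofReal (Real.exp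
      (halfTrace (a (φ n)) G - 1 / 2 * quadForm (a (φ n)) x - U x))) atTop = ⊤ := by
    intro x hx
    refine Tendsto.liminf_eq ?_
    have hc : Tendsto (fun n => halfTrace (‖a (φ n)‖⁻¹ • a (φ n)) G -
        1 / 2 * quadForm (‖a (φ n)‖⁻¹ • a (φ n)) x) atTop
        (𝓝 (halfTrace B G - 1 / 2 * quadForm B x)) :=
      (((continuous_halfTrace_left G).sub
        ((continuous_quadForm_left x).const_mul _)).tendsto B).comp hlim
    -- The A-dependent part of the exponent is ‖a‖ times a quantity converging to a positive limit
    -- on `O`.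
    have hexp : Tendsto (fun n => halfTrace (a (φ n)) G - 1 / 2 * quadForm (a (φ n)) x - U x)
        atTop atTop := by
      refine tendsto_atTop_add_const_right _ (-U x) ((hnorm.atTop_mul_pos (sub_pos.2 hx) hc).congr
        fun n => ?_)
      rw [halfTrace_smul_left, quadForm_smul]
      have := (hapos (φ n)).ne'
      field_simp
    exact ENNReal.tendsto_ofReal_atTop.comp (Real.tendsto_exp_atTop.comp hexp)
  -- Fatou on the open set `O`, which has positive volume, contradicts the uniform bound M.
  have htop : (⊤ : ℝ≥0∞) ≤ M := by
    calc (⊤ : ℝ≥0∞) = ∫⁻ _ in O, ⊤ := by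
          rw [setLIntegral_const, ENNReal.top_mul hOpos.ne']
      _ = ∫⁻ x in O, liminf (fun n => ENNReal.ofReal (Real.exp
            (halfTrace (a (φ n)) G - 1 / 2 * quadForm (a (φ n)) x - U x))) atTop :=
          setLIntegral_congr_fun hOopen.measurableSet fun x hx => (hinf x hx).symm
      _ ≤ ∫⁻ x, liminf (fun n => ENNReal.ofReal (Real.exp
            (halfTrace (a (φ n)) G - 1 / 2 * quadForm (a (φ n)) x - U x))) atTop :=
          setLIntegral_le_lintegral _ _
      _ ≤ liminf (fun n => expDual U G (a (φ n))) atTop :=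
          lintegral_liminf_le fun n => measurable_expDual_integrand hU G (a (φ n))
      _ ≤ liminf (fun _ : ℕ => M) atTop := liminf_le_liminf (Eventually.of_forall fun n => haM (φ n))
      _ = M := liminf_const M
  exact hM (top_le_iff.1 htop)

theorem expDual_eq_ofReal (hU : Measurable U) (G : SymMat N) {A : SymMat N}
    (hA : A ∈ effDom (freeEnergy U)) :
    expDual U G A =
      ENNReal.ofReal (Real.exp (halfTrace A G + Real.log (realPartition U A))) := by
  rw [expDual_eq hU, partitionFn_eq_ofReal hU hA, ← ENNReal.ofReal_mul (Real.exp_pos _).le,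
    Real.exp_add, Real.exp_log (realPartition_pos hU hA)]

/-- Direct method: a minimising sequence is eventually in a bounded sublevel set, and a
subsequential limit attains the infimum by semicontinuity. Finiteness of the minimum places the
limit in the effective domain. -/
theorem exists_forall_expDual_le (hU : WeakGrowth U) {G : SymMat N} (hG : G ∈ posDefCone N) :
    ∃ A ∈ effDom (freeEnergy U), ∀ B, expDual U G A ≤ expDual U G B := by
  have hm := hU.measurable
  obtain ⟨A₀, hA₀⟩ := exists_mem_effDom hU
  have h0 : expDual U G A₀ ≠ ⊤ := by rw [expDual_eq_ofReal hm G hA₀]; exact ENNReal.ofReal_ne_top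
  obtain ⟨m, -, hlim, hmem⟩ := exists_seq_tendsto_sInf (Set.range_nonempty (expDual U G))
    (OrderBot.bddBelow _)
  choose a ha using hmem
  have hlim' : Tendsto (fun n => expDual U G (a n)) atTop (𝓝 (sInf (Set.range (expDual U G)))) := by
    simpa only [ha] using hlim
  set I := sInf (Set.range (expDual U G)) with hI
  have hI_le : ∀ B, I ≤ expDual U G B := fun B => sInf_le ⟨B, rfl⟩
  have hI_top : I ≠ ⊤ := ((hI_le A₀).trans_lt h0.lt_top).ne
  have hev : ∀ᶠ n in atTop, expDual U G (a n) ≤ I + 1 :=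
    hlim'.eventually_le_const (ENNReal.lt_add_right hI_top one_ne_zero)
  have hproper : ProperSpace (SymMat N) := FiniteDimensional.proper ℝ _
  obtain ⟨A, -, φ, hφ, hA⟩ := tendsto_subseq_of_frequently_bounded
    (isBounded_expDual_sublevel hm hG (M := I + 1) (by simpa using hI_top)) hev.frequently
  have hAI : expDual U G A ≤ I :=
    (expDual_le_liminf hm G hA).trans_eq ((hlim'.comp hφ.tendsto_atTop).liminf_eq)
  refine ⟨A, mem_effDom_iff.2 fun htop => ?_, fun B => hAI.trans (hI_le B)⟩
  rw [expDual_eq hm, htop, ENNReal.mul_top (by simpa using Real.exp_pos _)] at hAI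
  exact hI_top (top_le_iff.1 hAI)

/-- The gradient of the free energy attains every positive definite matrix. -/
theorem exists_symGrad_freeEnergy_eq (hU : WeakGrowth U) {G : SymMat N} (hG : G ∈ posDefCone N) :
    ∃ A ∈ effDom (freeEnergy U), symGrad (fun A => (freeEnergy U A).toReal) A = G := by
  have hm := hU.measurable
  obtain ⟨A, hA, hmin⟩ := exists_forall_expDual_le hU hG
  refine ⟨A, hA, ?_⟩
  have hloc : IsLocalMin (fun B => halfTrace B G - (freeEnergy U B).toReal) A := by
    filter_upwards [(isOpen_effDom hU).mem_nhds hA] with B hB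
    have h := hmin B
    rw [expDual_eq_ofReal hm G hA, expDual_eq_ofReal hm G hB,
      ENNReal.ofReal_le_ofReal_iff (Real.exp_pos _).le, Real.exp_le_exp] at h
    rw [toReal_freeEnergy hm hA, toReal_freeEnergy hm hB]
    linarith
  obtain ⟨L, hL, -⟩ := hasFDerivAt_freeEnergy hU hA
  have h0 := hloc.hasFDerivAt_eq_zero ((halfTraceCLM G).hasFDerivAt.sub hL)
  rw [sub_eq_zero] at h0
  exact symGrad_eq_of_hasFDerivAt (h0 ▸ hL)

/-! ### The full Gibbs measure attains the supremum -/

/-- Half of the exponential absorbs the factor w. -/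
theorem mul_exp_neg_le {s w : ℝ} (h : s < w) : w * Real.exp (-w) ≤ 2 * Real.exp (-(s / 2)) := by
  have h1 : w ≤ 2 * Real.exp (w / 2) := by linarith [Real.add_one_le_exp (w / 2)]
  calc w * Real.exp (-w) ≤ 2 * Real.exp (w / 2) * Real.exp (-w) := by gcongr
    _ = 2 * Real.exp (-(w / 2)) := by rw [mul_assoc, ← Real.exp_add]; ring_nf
    _ ≤ 2 * Real.exp (-(s / 2)) := by gcongr

/-- U has no upper growth bound, so the weight itself must control it. Let w = ½xᵀAx + U. Where w ≤
‖x‖², U grows at most quadratically; where w > ‖x‖², the product w·exp(-w) is bounded by a Gaussian.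
-/
theorem integrable_gibbsWeight_mul_potential (hU : WeakGrowth U) {A : SymMat N}
    (hA : A ∈ effDom (freeEnergy U)) : Integrable fun x => gibbsWeight U A x * U x := by
  obtain ⟨C, hC⟩ := hU.bound
  have hs := integrable_pow_mul_gibbsWeight hU hA 1
  simp only [pow_one] at hs
  set c : ℝ := (N : ℝ) ^ 2 * ‖A‖ with hc
  have hc0 : 0 ≤ c := by positivity
  refine ((hs.const_mul (1 + |C| + 2 * c)).add
    ((integrable_exp_neg_mul_norm_sq (N := N) (c := 1 / 2) (by norm_num)).const_mul 2)).mono'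
    ((measurable_gibbsWeight hU.measurable A).mul hU.measurable).aestronglyMeasurable
    (Eventually.of_forall fun x => ?_)
  have hW := gibbsWeight_pos (U := U) A x
  set s := ‖x‖ ^ 2 with hs_def
  have hs0 : 0 ≤ s := sq_nonneg _
  have hq : |quadForm A x| ≤ c * s := abs_quadForm_le A x
  have hq' := abs_le.1 hq
  have hCs : -(|C| * (1 + s)) ≤ U x := by nlinarith [hC x, le_abs_self C]
  have hcs : 0 ≤ c * s := mul_nonneg hc0 hs0
  have hE : 0 < Real.exp (-(1 / 2) * s) := Real.exp_pos _
  rw [norm_mul, Real.norm_of_nonneg hW.le, Real.norm_eq_abs]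
  have hfst : 0 ≤ |C| * (1 + s) := by positivity
  change gibbsWeight U A x * |U x| ≤
    (1 + |C| + 2 * c) * ((1 + s) * gibbsWeight U A x) + 2 * Real.exp (-(1 / 2) * s)
  rcases le_or_gt (1 / 2 * quadForm A x + U x) s with h | h
  · have hb : |U x| ≤ (1 + |C| + 2 * c) * (1 + s) := abs_le.2 ⟨by nlinarith, by nlinarith⟩
    nlinarith [mul_le_mul_of_nonneg_left hb hW.le]
  · have h1 := mul_exp_neg_le h
    have h2 : Real.exp (-(1 / 2 * quadForm A x + U x)) = gibbsWeight U A x := by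
      rw [gibbsWeight]; ring_nf
    have h3 : Real.exp (-(s / 2)) = Real.exp (-(1 / 2) * s) := by ring_nf
    rw [h2, h3] at h1
    have hb : |U x| ≤ (1 / 2 * quadForm A x + U x) + (1 + |C| + 2 * c) * (1 + s) :=
      abs_le.2 ⟨by nlinarith, by nlinarith⟩
    nlinarith [mul_le_mul_of_nonneg_left hb hW.le]

theorem integrable_gibbsWeight_mul_norm_sq (hU : WeakGrowth U) {A : SymMat N}
    (hA : A ∈ effDom (freeEnergy U)) : Integrable fun x => gibbsWeight U A x * ‖x‖ ^ 2 :=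
  integrable_gibbsWeight_mul hU (g := fun x => ‖x‖ ^ 2) (by fun_prop) (C := 1) (k := 1) (fun x => by
    rw [Real.norm_of_nonneg (sq_nonneg _)]; linarith) hA

theorem gibbsSecondMoment_univ (hU : WeakGrowth U) {A : SymMat N}
    (hA : A ∈ effDom (freeEnergy U)) :
    gibbsSecondMoment U A Set.univ = symGrad (fun A => (freeEnergy U A).toReal) A := by
  ext i j
  rw [symGrad_freeEnergy_apply hU hA]
  simp [gibbsSecondMoment, realPartition]

theorem dualFn_symGrad_freeEnergy (hU : WeakGrowth U) {A : SymMat N}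
    (hA : A ∈ effDom (freeEnergy U)) :
    dualFn U (symGrad (fun A => (freeEnergy U A).toReal) A) =
      ((halfTrace A (symGrad (fun A => (freeEnergy U A).toReal) A) +
        Real.log (realPartition U A) : ℝ) : EReal) := by
  refine le_antisymm (dualFn_le hU hA _) ?_
  have hz : 0 < ∫ y in Set.univ, gibbsWeight U A y := by
    rw [setIntegral_univ]; exact realPartition_pos hU.measurable hA
  have h := le_dualFn_gibbsSecondMoment hU.measurable MeasurableSet.univ hz
    (integrable_gibbsWeight_mul_norm_sq hU hA).integrableOn
    (integrable_gibbsWeight_mul_potential hU hA).integrableOn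
  rwa [gibbsSecondMoment_univ hU hA, setIntegral_univ] at h

/-- F is finite at this matrix because the Gibbs measure attains it, whereas F is -∞ off the
positive definite cone. -/
theorem symGrad_freeEnergy_mem_posDefCone (hU : WeakGrowth U) {A : SymMat N}
    (hA : A ∈ effDom (freeEnergy U)) :
    symGrad (fun A => (freeEnergy U A).toReal) A ∈ posDefCone N := by
  by_contra h
  have h1 := dualFn_symGrad_freeEnergy hU hA
  rw [dualFn_eq_bot h] at h1
  exact EReal.bot_ne_coe _ h1

theorem effDom_dualFn (hU : WeakGrowth U) : effDom (dualFn U) = posDefCone N := by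
  ext G
  refine ⟨fun hG => ?_, fun hG => ?_⟩
  · by_contra h
    have : ⊥ < dualFn U G := hG
    rw [dualFn_eq_bot h] at this
    exact lt_irrefl _ this
  · obtain ⟨A, hA, rfl⟩ := exists_symGrad_freeEnergy_eq hU hG
    change ⊥ < dualFn U _
    rw [dualFn_symGrad_freeEnergy hU hA]
    exact EReal.bot_lt_coe _

/-- `F` is the concave conjugate of `Ω`. -/
theorem dualFn_eq_concaveConj (hU : WeakGrowth U) (G : SymMat N) :
    dualFn U G = concaveConj (freeEnergy U) G := by
  by_cases hG : G ∈ posDefCone N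
  · refine le_antisymm (le_iInf fun A => ?_) ?_
    · by_cases hA : A ∈ effDom (freeEnergy U)
      · rw [freeEnergy_eq_coe hU.measurable hA, ← EReal.coe_sub, sub_neg_eq_add]
        exact dualFn_le hU hA G
      · have : freeEnergy U A = ⊥ := by simpa [effDom] using hA
        rw [this, EReal.coe_sub_bot]
        exact le_top
    · obtain ⟨A, hA, rfl⟩ := exists_symGrad_freeEnergy_eq hU hG
      rw [dualFn_symGrad_freeEnergy hU hA]
      exact concaveConj_le hU.measurable hA _
  · rw [dualFn_eq_bot hG, concaveConj_eq_bot hU hG]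

theorem coe_toReal_dualFn (hU : WeakGrowth U) {G : SymMat N} (hG : G ∈ posDefCone N) :
    ((dualFn U G).toReal : EReal) = dualFn U G :=
  EReal.coe_toReal (dualFn_ne_top hU G) (by
    rw [← effDom_dualFn hU] at hG
    exact ne_of_gt hG)

theorem toReal_dualFn_le (hU : WeakGrowth U) {A G : SymMat N} (hA : A ∈ effDom (freeEnergy U))
    (hG : G ∈ posDefCone N) :
    (dualFn U G).toReal ≤ halfTrace A G - (freeEnergy U A).toReal := by
  have h := dualFn_le hU hA G
  rw [← coe_toReal_dualFn hU hG, EReal.coe_le_coe_iff] at h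
  rw [toReal_freeEnergy hU.measurable hA]
  linarith

/-- Equality in the Fenchel inequality characterises the gradient of the free energy. -/
theorem toReal_dualFn_eq_iff (hU : WeakGrowth U) {A G : SymMat N}
    (hA : A ∈ effDom (freeEnergy U)) (hG : G ∈ posDefCone N) :
    (dualFn U G).toReal = halfTrace A G - (freeEnergy U A).toReal ↔
      symGrad (fun A => (freeEnergy U A).toReal) A = G := by
  refine ⟨fun h => ?_, ?_⟩
  -- Equality says that A minimises the dual functional for G; being interior, it is critical.
  · have hloc : IsLocalMin (fun B => halfTrace B G - (freeEnergy U B).toReal) A := by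
      filter_upwards [(isOpen_effDom hU).mem_nhds hA] with B hB
      rw [← h]
      exact toReal_dualFn_le hU hB hG
    obtain ⟨L, hL, -⟩ := hasFDerivAt_freeEnergy hU hA
    have h0 := hloc.hasFDerivAt_eq_zero ((halfTraceCLM G).hasFDerivAt.sub hL)
    rw [sub_eq_zero] at h0
    exact symGrad_eq_of_hasFDerivAt (h0 ▸ hL)
  · rintro rfl
    rw [dualFn_symGrad_freeEnergy hU hA, EReal.toReal_coe, toReal_freeEnergy hU.measurable hA,
      sub_neg_eq_add]

/-! ### Strict concavity -/

/-- Hölder's inequality with its equality case: normalise both weights to mass one, apply convexity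
of exp pointwise and integrate. It is strict where the log densities s and t differ. -/
theorem realPartition_convex_comb_lt (hU : WeakGrowth U) {A B : SymMat N}
    (hA : A ∈ effDom (freeEnergy U)) (hB : B ∈ effDom (freeEnergy U)) {a b : ℝ} (ha : 0 < a)
    (hb : 0 < b) (hab : a + b = 1) :
    a • A + b • B ∈ effDom (freeEnergy U) ∧ (A ≠ B → realPartition U (a • A + b • B) <
      Real.exp (a * Real.log (realPartition U A) + b * Real.log (realPartition U B))) := by
  have hm := hU.measurable
  have hZA := realPartition_pos hm hA
  have hZB := realPartition_pos hm hB
  set zA := Real.log (realPartition U A) with hzA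
  set zB := Real.log (realPartition U B) with hzB
  set T := Real.exp (a * zA + b * zB) with hT
  have hTpos : 0 < T := Real.exp_pos _
  set s : EuclideanSpace ℝ (Fin N) → ℝ := fun x => -(1 / 2) * quadForm A x - U x - zA with hs
  set t : EuclideanSpace ℝ (Fin N) → ℝ := fun x => -(1 / 2) * quadForm B x - U x - zB with ht
  have hW : ∀ x, gibbsWeight U (a • A + b • B) x = T * Real.exp (a * s x + b * t x) := fun x => by
    rw [gibbsWeight, hT, ← Real.exp_add, quadForm_add, quadForm_smul, quadForm_smul]
    congr 1
    have : U x = a * U x + b * U x := by rw [← add_mul, hab, one_mul]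
    simp only [hs, ht]
    linear_combination -this
  have hes : ∀ x, Real.exp (s x) = (realPartition U A)⁻¹ * gibbsWeight U A x := fun x => by
    rw [hs, Real.exp_sub, hzA, Real.exp_log hZA, gibbsWeight]; ring
  have het : ∀ x, Real.exp (t x) = (realPartition U B)⁻¹ * gibbsWeight U B x := fun x => by
    rw [ht, Real.exp_sub, hzB, Real.exp_log hZB, gibbsWeight]; ring
  have hle : ∀ x, Real.exp (a * s x + b * t x) ≤ a * Real.exp (s x) + b * Real.exp (t x) := fun x =>
    convexOn_exp.2 (Set.mem_univ _) (Set.mem_univ _) ha.le hb.le hab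
  have hiA : Integrable fun x => Real.exp (s x) := by
    simp only [hes]; exact ((mem_effDom_iff_integrable hm).1 hA).const_mul _
  have hiB : Integrable fun x => Real.exp (t x) := by
    simp only [het]; exact ((mem_effDom_iff_integrable hm).1 hB).const_mul _
  have h1A : ∫ x, Real.exp (s x) = 1 := by
    simp only [hes]; rw [integral_const_mul]; exact inv_mul_cancel₀ hZA.ne'
  have h1B : ∫ x, Real.exp (t x) = 1 := by
    simp only [het]; rw [integral_const_mul]; exact inv_mul_cancel₀ hZB.ne'
  have hsum : Integrable fun x => a * Real.exp (s x) + b * Real.exp (t x) :=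
    (hiA.const_mul a).add (hiB.const_mul b)
  have hsm : Measurable s := (((continuous_quadForm A).measurable.const_mul _).sub hm).sub_const _
  have htm : Measurable t := (((continuous_quadForm B).measurable.const_mul _).sub hm).sub_const _
  have hcomb : Integrable fun x => Real.exp (a * s x + b * t x) := by
    refine hsum.mono' (Real.measurable_exp.comp
      ((hsm.const_mul a).add (htm.const_mul b))).aestronglyMeasurable
      (Eventually.of_forall fun x => ?_)
    rw [Real.norm_of_nonneg (Real.exp_pos _).le]
    exact hle x
  refine ⟨(mem_effDom_iff_integrable hm).2 ?_, fun hne => ?_⟩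
  · rw [funext hW]
    exact hcomb.const_mul T
  -- The potential cancels in s - t, so the set is open although U is merely measurable.
  have hopen : IsOpen {x | s x ≠ t x} := by
    have : {x | s x ≠ t x} = {x | -(1 / 2) * quadForm A x - zA ≠ -(1 / 2) * quadForm B x - zB} := by
      ext x
      simp only [hs, ht, Set.mem_ofPred_eq, not_iff_not, ne_eq]
      constructor <;> intro h <;> linarith
    rw [this]
    exact isOpen_ne_fun (((continuous_quadForm A).const_mul _).sub continuous_const)
      (((continuous_quadForm B).const_mul _).sub continuous_const)
  have hnonempty : {x | s x ≠ t x}.Nonempty := by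
    by_contra h
    rw [Set.not_nonempty_iff_eq_empty, Set.eq_empty_iff_forall_notMem] at h
    have hst : ∀ x, s x = t x := fun x => not_not.1 (h x)
    refine hne (sub_eq_zero.1 (eq_zero_of_quadForm_eq_zero fun x => ?_))
    -- The value at 0 equates the normalising constants, so the quadratic forms must agree.
    have h0 := hst 0
    have hx := hst x
    simp only [hs, ht, quadForm_zero_vec] at h0 hx
    rw [quadForm_sub]
    linarith
  have hpos : 0 < ∫ x, (a * Real.exp (s x) + b * Real.exp (t x) - Real.exp (a * s x + b * t x)) := by
    refine (integral_pos_iff_support_of_nonneg (fun x => sub_nonneg.2 (hle x))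
      (hsum.sub hcomb)).2 ((hopen.measure_pos volume hnonempty).trans_le (measure_mono ?_))
    intro x hx
    exact (sub_pos.2 (strictConvexOn_exp.2 (Set.mem_univ _) (Set.mem_univ _) hx ha hb hab)).ne'
  rw [integral_sub hsum hcomb, integral_add (hiA.const_mul a) (hiB.const_mul b),
    integral_const_mul, integral_const_mul, h1A, h1B, mul_one, mul_one, hab] at hpos
  rw [realPartition, funext hW, integral_const_mul]
  nlinarith

theorem strictConcaveOn_freeEnergy (hU : WeakGrowth U) :
    StrictConcaveOn ℝ (effDom (freeEnergy U)) fun A => (freeEnergy U A).toReal := by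
  have hm := hU.measurable
  refine ⟨convex_iff_forall_pos.2 fun A hA B hB a b ha hb hab =>
    (realPartition_convex_comb_lt hU hA hB ha hb hab).1, fun A hA B hB hne a b ha hb hab => ?_⟩
  obtain ⟨hmem, hlt⟩ := realPartition_convex_comb_lt hU hA hB ha hb hab
  have h := Real.log_lt_log (realPartition_pos hm hmem) (hlt hne)
  rw [Real.log_exp] at h
  simp only [toReal_freeEnergy hm hA, toReal_freeEnergy hm hB, toReal_freeEnergy hm hmem,
    smul_eq_mul]
  linarith

/-- Two points with gradient G both minimise the dual functional, and by strict concavity their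
midpoint would do better than the minimum. -/
theorem injOn_symGrad_freeEnergy (hU : WeakGrowth U) :
    Set.InjOn (symGrad fun A => (freeEnergy U A).toReal) (effDom (freeEnergy U)) := by
  intro A hA B hB hAB
  by_contra hne
  have hG := symGrad_freeEnergy_mem_posDefCone hU hA
  set G := symGrad (fun A => (freeEnergy U A).toReal) A with hGdef
  have h1 := (toReal_dualFn_eq_iff hU hA hG).2 hGdef.symm
  have h2 := (toReal_dualFn_eq_iff hU hB hG).2 hAB.symm
  have hhalf : (0 : ℝ) < 1 / 2 := by norm_num
  have hs := (strictConcaveOn_freeEnergy hU).2 hA hB hne hhalf hhalf (by norm_num)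
  have h3 := toReal_dualFn_le hU ((strictConcaveOn_freeEnergy hU).1 hA hB hhalf.le hhalf.le
    (by norm_num)) hG
  rw [halfTrace_add_left, halfTrace_smul_left, halfTrace_smul_left] at h3
  simp only [smul_eq_mul] at hs
  linarith

/-- The gradient of the free energy is a bijection onto the positive definite matrices. -/
theorem bijOn_symGrad_freeEnergy (hU : WeakGrowth U) :
    Set.BijOn (symGrad fun A => (freeEnergy U A).toReal) (effDom (freeEnergy U)) (posDefCone N) :=
  ⟨fun _ hA => symGrad_freeEnergy_mem_posDefCone hU hA, injOn_symGrad_freeEnergy hU,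
    fun _ hG => exists_symGrad_freeEnergy_eq hU hG⟩

theorem convex_posDefCone : Convex ℝ (posDefCone N) :=
  convex_iff_forall_pos.2 fun A hA B hB a b ha hb _ => mem_posDefCone.2 fun x hx => by
    have h1 := mem_posDefCone.1 hA x hx
    have h2 := mem_posDefCone.1 hB x hx
    rw [quadForm_add, quadForm_smul, quadForm_smul]
    positivity

/-- Take A with gradient equal to the convex combination. Its affine bound is attained there, and
attaining it at G₁ too would force the combination to equal G₁: strictness of F comes from
uniqueness of the gradient of Ω. -/
theorem strictConcaveOn_dualFn (hU : WeakGrowth U) :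
    StrictConcaveOn ℝ (posDefCone N) fun G => (dualFn U G).toReal := by
  refine ⟨convex_posDefCone, fun G₁ h₁ G₂ h₂ hne a b ha hb hab => ?_⟩
  have hG := convex_posDefCone h₁ h₂ ha.le hb.le hab
  obtain ⟨A, hA, hAG⟩ := exists_symGrad_freeEnergy_eq hU hG
  have hval := (toReal_dualFn_eq_iff hU hA hG).2 hAG
  have hlt : (dualFn U G₁).toReal < halfTrace A G₁ - (freeEnergy U A).toReal := by
    refine lt_of_le_of_ne (toReal_dualFn_le hU hA h₁) fun h => hne ?_
    have h3 := hAG.symm.trans ((toReal_dualFn_eq_iff hU hA h₁).1 h)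
    have h4 : b • G₂ = b • G₁ := by
      have : (a • G₁ + b • G₂) = a • G₁ + b • G₁ := by rw [h3, ← add_smul, hab, one_smul]
      exact add_left_cancel this
    exact (smul_right_injective _ hb.ne' h4).symm
  have hle := toReal_dualFn_le hU hA h₂
  rw [halfTrace_add_right, halfTrace_smul_right, halfTrace_smul_right] at hval
  simp only [smul_eq_mul]
  rw [hval]
  have hΩ : (freeEnergy U A).toReal = a * (freeEnergy U A).toReal + b * (freeEnergy U A).toReal := by
    rw [← add_mul, hab, one_mul]
  rw [hΩ]
  nlinarith [mul_lt_mul_of_pos_left hlt ha, mul_le_mul_of_nonneg_left hle hb.le]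

/-! ### Smooth inverses -/

section SmoothInverse

variable {E : Type} [NormedAddCommGroup E] [NormedSpace ℝ E]

theorem contDiffOn_fderiv_apply {f : E → ℝ} {D : Set E} (hD : IsOpen D) (hf : ContDiffOn ℝ ∞ f D)
    (v : E) : ContDiffOn ℝ ∞ (fun A => fderiv ℝ f A v) D :=
  (hf.fderiv_of_isOpen hD (by simp)).clm_apply contDiffOn_const

/-- A smooth map of a finite-dimensional space with injective derivative that is a bijection between
`D` and `S` has a smooth inverse. -/
theorem contDiffOn_of_leftInvOn [FiniteDimensional ℝ E] {Φ Ψ : E → E} {D S : Set E}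
    (hD : IsOpen D) (hΦ : ContDiffOn ℝ ∞ Φ D) (hsurj : Set.SurjOn Φ D S)
    (hinv : Set.LeftInvOn Ψ Φ D) (hinj : ∀ A ∈ D, ∀ v, fderiv ℝ Φ A v = 0 → v = 0) :
    ContDiffOn ℝ ∞ Ψ S ∧ S ⊆ interior (Φ '' D) := by
  have hcomplete : CompleteSpace E := FiniteDimensional.complete ℝ E
  have key : ∀ A ∈ D, ContDiffAt ℝ ∞ Ψ (Φ A) ∧ Φ '' D ∈ 𝓝 (Φ A) := by
    intro A hA
    have hat : ContDiffAt ℝ ∞ Φ A := hΦ.contDiffAt (hD.mem_nhds hA)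
    have hker : Function.Injective (fderiv ℝ Φ A : E →ₗ[ℝ] E) :=
      (injective_iff_map_eq_zero _).2 fun v hv => hinj A hA v hv
    set e : E ≃L[ℝ] E := (LinearEquiv.ofInjectiveEndo _ hker).toContinuousLinearEquiv with he
    have hderiv : HasFDerivAt Φ (e : E →L[ℝ] E) A := by
      refine (hat.differentiableAt (by simp)).hasFDerivAt.congr_fderiv ?_
      ext v
      simp [he]
    have hn : (∞ : WithTop ℕ∞) ≠ 0 := by simp
    have hstrict : HasStrictFDerivAt Φ (e : E →L[ℝ] E) A := hat.hasStrictFDerivAt' hderiv hn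
    have hloc := hat.to_localInverse hderiv hn
    have hright : ∀ᶠ y in 𝓝 (Φ A), Φ (hat.localInverse hderiv hn y) = y :=
      hstrict.eventually_right_inverse
    have himg : hat.localInverse hderiv hn (Φ A) = A := hstrict.localInverse_apply_image
    have hmem : ∀ᶠ y in 𝓝 (Φ A), hat.localInverse hderiv hn y ∈ D := by
      refine hloc.continuousAt.eventually_mem ?_
      rw [himg]
      exact hD.mem_nhds hA
    -- The left inverse property holds only on `D`, so Ψ agrees with the local inverse once the
    -- latter takes values in `D`.
    refine ⟨hloc.congr_of_eventuallyEq ?_, ?_⟩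
    · filter_upwards [hright, hmem] with y h1 h2
      rw [← hinv h2, h1]
    · filter_upwards [hright, hmem] with y h1 h2 using ⟨_, h2, h1⟩
  constructor
  · intro G hG
    obtain ⟨A, hA, rfl⟩ := hsurj hG
    exact (key A hA).1.contDiffWithinAt
  · intro G hG
    obtain ⟨A, hA, rfl⟩ := hsurj hG
    exact mem_interior_iff_mem_nhds.2 (key A hA).2

end SmoothInverse

/-! ### The Hessian of the free energy -/

theorem contDiffOn_symGrad {f : SymMat N → ℝ} {D : Set (SymMat N)} (hD : IsOpen D)
    (hf : ContDiffOn ℝ ∞ f D) : ContDiffOn ℝ ∞ (symGrad f) D := by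
  have h : ∀ A ∈ D, symGrad f A =
      (1 / 2 : ℝ) • ∑ i, ∑ j, fderiv ℝ f A (symUnit i j) • symUnit i j := fun A hA => by
    have hd : HasFDerivAt f (fderiv ℝ f A) A :=
      ((hf.contDiffAt (hD.mem_nhds hA)).differentiableAt (by simp)).hasFDerivAt
    conv_lhs => rw [eq_sum_symUnit (symGrad f A)]
    simp only [symGrad_apply_of_hasFDerivAt hd]
  refine ContDiffOn.congr ?_ h
  refine ContDiffOn.const_smul _ (ContDiffOn.sum fun i _ => ContDiffOn.sum fun j _ => ?_)
  exact (contDiffOn_fderiv_apply hD hf (symUnit i j)).smul contDiffOn_const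

theorem norm_halfQuadForm_le (B : SymMat N) (x : EuclideanSpace ℝ (Fin N)) :
    ‖1 / 2 * quadForm B x‖ ≤ ((N : ℝ) ^ 2 * ‖B‖) * (1 + ‖x‖ ^ 2) ^ 1 := by
  rw [norm_mul, Real.norm_eq_abs (quadForm B x), Real.norm_of_nonneg (by norm_num)]
  have h := abs_quadForm_le B x
  have h0 : 0 ≤ (N : ℝ) ^ 2 * ‖B‖ := by positivity
  nlinarith [abs_nonneg (quadForm B x)]

/-- The variance of a nonzero quadratic form under a Gibbs measure is positive. -/
theorem gibbs_variance_pos (hU : WeakGrowth U) {A B : SymMat N} (hA : A ∈ effDom (freeEnergy U))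
    (hB : B ≠ 0) :
    (∫ x, gibbsWeight U A x * (1 / 2 * quadForm B x)) ^ 2 <
      gibbsMoment U (fun x => 1 / 2 * quadForm B x * (1 / 2 * quadForm B x)) A *
        realPartition U A := by
  have hm := hU.measurable
  have hZ := realPartition_pos hm hA
  set h : EuclideanSpace ℝ (Fin N) → ℝ := fun x => 1 / 2 * quadForm B x with hh
  have hcont : Continuous h := (continuous_quadForm B).const_mul _
  set M := ∫ x, gibbsWeight U A x * h x with hM
  set S := gibbsMoment U (fun x => h x * h x) A with hS
  set m := M / realPartition U A with hmdef
  have h0 : Integrable (gibbsWeight U A) := (mem_effDom_iff_integrable hm).1 hA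
  have h1 : Integrable fun x => gibbsWeight U A x * h x :=
    integrable_gibbsWeight_mul hU hcont (norm_halfQuadForm_le B) hA
  have h2 : Integrable fun x => gibbsWeight U A x * (h x * h x) :=
    integrable_gibbsWeight_mul hU (g := fun x => h x * h x) (hcont.mul hcont) (k := 2) (C := ((N : ℝ) ^ 2 * ‖B‖) ^ 2)
      (fun x => by
        rw [norm_mul]
        refine (mul_le_mul (norm_halfQuadForm_le B x) (norm_halfQuadForm_le B x) (norm_nonneg _)
          (by positivity)).trans (le_of_eq ?_)
        ring) hA
  have hsq : ∀ x, gibbsWeight U A x * (h x - m) ^ 2 = gibbsWeight U A x * (h x * h x) -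
      2 * m * (gibbsWeight U A x * h x) + m ^ 2 * gibbsWeight U A x := fun x => by ring
  have hint : Integrable fun x => gibbsWeight U A x * (h x - m) ^ 2 := by
    simp only [hsq]
    exact (h2.sub (h1.const_mul _)).add (h0.const_mul _)
  have hval : ∫ x, gibbsWeight U A x * (h x - m) ^ 2 =
      S - 2 * m * M + m ^ 2 * realPartition U A := by
    simp only [hsq]
    have e1 := integral_add (h2.sub (h1.const_mul (2 * m))) (h0.const_mul (m ^ 2))
    have e2 := integral_sub h2 (h1.const_mul (2 * m))
    simp only [Pi.sub_apply] at e1 e2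
    rw [e1, e2, integral_const_mul, integral_const_mul]
    rfl
  have hne : {x | h x ≠ m}.Nonempty := by
    by_contra hempty
    rw [Set.not_nonempty_iff_eq_empty, Set.eq_empty_iff_forall_notMem] at hempty
    have hall : ∀ x, h x = m := fun x => not_not.1 (hempty x)
    refine hB (eq_zero_of_quadForm_eq_zero fun x => ?_)
    have e0 := hall 0
    have ex := hall x
    simp only [hh, quadForm_zero_vec] at e0 ex
    linarith
  have hpos : 0 < ∫ x, gibbsWeight U A x * (h x - m) ^ 2 := by
    refine (integral_pos_iff_support_of_nonneg (fun x => mul_nonneg (gibbsWeight_pos A x).le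
      (sq_nonneg _)) hint).2 (((isOpen_ne_fun hcont continuous_const).measure_pos volume
        hne).trans_le (measure_mono fun x hx => ?_))
    exact (mul_pos (gibbsWeight_pos A x) (by have := sub_ne_zero.2 hx; positivity)).ne'
  rw [hval] at hpos
  -- Here m is the Gibbs mean; multiplying the positive variance integral by Z clears the
  -- denominators.
  have hmZ : m * realPartition U A = M := div_mul_cancel₀ _ hZ.ne'
  nlinarith [mul_pos hpos hZ]

/-- The Hessian of the free energy is nondegenerate. -/
theorem fderiv_symGrad_freeEnergy_injective (hU : WeakGrowth U) {A : SymMat N}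
    (hA : A ∈ effDom (freeEnergy U)) (B : SymMat N)
    (hB : fderiv ℝ (symGrad fun A => (freeEnergy U A).toReal) A B = 0) : B = 0 := by
  by_contra hne
  have hm := hU.measurable
  have hZ := realPartition_pos hm hA
  have hΦ := ((contDiffOn_symGrad (isOpen_effDom hU) (contDiffOn_freeEnergy hU)).contDiffAt
    ((isOpen_effDom hU).mem_nhds hA)).differentiableAt (by simp) |>.hasFDerivAt
  have h1 := (halfTraceCLM B).hasFDerivAt.comp A hΦ
  obtain ⟨L₁, hL₁, hL₁B⟩ := hasFDerivAt_gibbsMoment hU (g := fun x => 1 / 2 * quadForm B x)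
    ((continuous_quadForm B).const_mul _) (norm_halfQuadForm_le B) hA
  obtain ⟨L₀, hL₀, hL₀B⟩ := hasFDerivAt_realPartition hU hA
  have hmul : ∀ A' ∈ effDom (freeEnergy U),
      halfTraceCLM B (symGrad (fun A => (freeEnergy U A).toReal) A') * realPartition U A' =
        gibbsMoment U (fun x => 1 / 2 * quadForm B x) A' := fun A' hA' => by
    rw [halfTraceCLM_apply, halfTrace_comm, halfTrace_symGrad_freeEnergy hU hA', gibbsHalfForm,
      gibbsMoment, mul_comm, mul_inv_cancel_left₀ (realPartition_pos hm hA').ne']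
  have h2 := (h1.mul hL₀).congr_of_eventuallyEq
    (f₁ := gibbsMoment U fun x => 1 / 2 * quadForm B x) (by
    filter_upwards [(isOpen_effDom hU).mem_nhds hA] with A' hA' using (hmul A' hA').symm)
  have h3 := DFunLike.congr_fun (h2.unique hL₁) B
  have h4 := hmul A hA
  have hvar := gibbs_variance_pos hU hA hne
  simp only [Function.comp_apply, add_apply, smul_apply, ContinuousLinearMap.comp_apply, hB,
    map_zero, hL₁B, hL₀B, smul_eq_mul, mul_zero, add_zero, mul_neg, neg_inj] at h3
  have hM : gibbsMoment U (fun x => 1 / 2 * quadForm B x) A =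
      ∫ x, gibbsWeight U A x * (1 / 2 * quadForm B x) := rfl
  rw [hM] at h4
  rw [← h3, ← h4] at hvar
  linarith

/-! ### Smoothness of the dual functional -/

/-- The inverse of the gradient of the free energy. -/
noncomputable def gradInverse (U : EuclideanSpace ℝ (Fin N) → ℝ) : SymMat N → SymMat N :=
  Function.invFunOn (symGrad fun A => (freeEnergy U A).toReal) (effDom (freeEnergy U))

theorem invOn_gradInverse (hU : WeakGrowth U) :
    Set.InvOn (gradInverse U) (symGrad fun A => (freeEnergy U A).toReal)
      (effDom (freeEnergy U)) (posDefCone N) :=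
  (bijOn_symGrad_freeEnergy hU).invOn_invFunOn

theorem gradInverse_mem (hU : WeakGrowth U) {G : SymMat N} (hG : G ∈ posDefCone N) :
    gradInverse U G ∈ effDom (freeEnergy U) :=
  Function.invFunOn_mem (exists_symGrad_freeEnergy_eq hU hG)

/-- Openness of the cone comes along for free, as the image of a local diffeomorphism. -/
theorem contDiffOn_gradInverse (hU : WeakGrowth U) :
    ContDiffOn ℝ ∞ (gradInverse U) (posDefCone N) ∧ IsOpen (posDefCone N) := by
  obtain ⟨h1, h2⟩ := contDiffOn_of_leftInvOn (isOpen_effDom hU)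
    (contDiffOn_symGrad (isOpen_effDom hU) (contDiffOn_freeEnergy hU))
    (bijOn_symGrad_freeEnergy hU).surjOn (invOn_gradInverse hU).1
    fun A hA B hB => fderiv_symGrad_freeEnergy_injective hU hA B hB
  rw [(bijOn_symGrad_freeEnergy hU).image_eq] at h2
  exact ⟨h1, subset_interior_iff_isOpen.1 h2⟩

theorem toReal_dualFn_eq (hU : WeakGrowth U) {G : SymMat N} (hG : G ∈ posDefCone N) :
    (dualFn U G).toReal = halfTrace (gradInverse U G) G - (freeEnergy U (gradInverse U G)).toReal :=
  (toReal_dualFn_eq_iff hU (gradInverse_mem hU hG) hG).2 ((invOn_gradInverse hU).2 hG)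

theorem halfTrace_eq_sum_symUnit (A G : SymMat N) :
    halfTrace A G = (1 / 2) * ∑ i, ∑ j, halfTraceCLM (symUnit i j) A *
      halfTraceCLM (symUnit i j) G := by
  rw [halfTrace_eq_sum]
  congr 1
  refine Finset.sum_congr rfl fun i _ => Finset.sum_congr rfl fun j _ => ?_
  rw [halfTraceCLM_apply, halfTraceCLM_apply, halfTrace_comm A, halfTrace_comm G,
    halfTrace_symUnit_left, halfTrace_symUnit_left]

theorem contDiffOn_dualFn (hU : WeakGrowth U) :
    ContDiffOn ℝ ∞ (fun G => (dualFn U G).toReal) (posDefCone N) := by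
  have hΨ := (contDiffOn_gradInverse hU).1
  refine ContDiffOn.congr ?_ fun G hG => toReal_dualFn_eq hU hG
  refine ContDiffOn.sub ?_ ((contDiffOn_freeEnergy hU).comp hΨ fun G hG => gradInverse_mem hU hG)
  simp only [halfTrace_eq_sum_symUnit]
  refine contDiffOn_const.mul (ContDiffOn.sum fun i _ => ContDiffOn.sum fun j _ => ?_)
  exact ((halfTraceCLM (symUnit i j)).contDiff.comp_contDiffOn hΨ).mul
    (halfTraceCLM (symUnit i j)).contDiff.contDiffOn

/-- Envelope argument: with A the preimage of G, the map G' ↦ F[G'] - ⟨G', A⟩ is bounded by -Ω[A]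
and attains the bound at G, so its derivative vanishes there. -/
theorem symGrad_dualFn (hU : WeakGrowth U) {G : SymMat N} (hG : G ∈ posDefCone N) :
    symGrad (fun G => (dualFn U G).toReal) G = gradInverse U G := by
  have hopen := (contDiffOn_gradInverse hU).2
  have hA := gradInverse_mem hU hG
  have hd := ((contDiffOn_dualFn hU).contDiffAt (hopen.mem_nhds hG)).differentiableAt (by simp)
    |>.hasFDerivAt
  have hloc : IsLocalMax
      (fun G' => (dualFn U G').toReal - halfTrace G' (gradInverse U G)) G := by
    filter_upwards [hopen.mem_nhds hG] with G' hG'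
    have h1 := toReal_dualFn_le hU hA hG'
    have h2 := toReal_dualFn_eq hU hG
    rw [halfTrace_comm] at h1 h2
    linarith
  have h0 := hloc.hasFDerivAt_eq_zero (hd.sub (halfTraceCLM (gradInverse U G)).hasFDerivAt)
  rw [sub_eq_zero] at h0
  exact symGrad_eq_of_hasFDerivAt (h0 ▸ hd)

theorem invOn_symGrad_dualFn (hU : WeakGrowth U) :
    Set.InvOn (symGrad fun G => (dualFn U G).toReal) (symGrad fun A => (freeEnergy U A).toReal)
      (effDom (freeEnergy U)) (posDefCone N) := by
  refine ⟨fun A hA => ?_, fun G hG => ?_⟩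
  · rw [symGrad_dualFn hU (symGrad_freeEnergy_mem_posDefCone hU hA)]
    exact (invOn_gradInverse hU).1 hA
  · rw [symGrad_dualFn hU hG]
    exact (invOn_gradInverse hU).2 hG

end LuttingerWard

open LuttingerWard in
theorem theorem3p1 {N : ℕ} (U : EuclideanSpace ℝ (Fin N) → ℝ) (hU : WeakGrowth U) :
    -- variational formula for the free energy
    (∀ A : SymMat N, freeEnergy U A =
      ⨅ G ∈ posSemidefCone N, ((halfTrace A G : ℝ) : EReal) - dualFn U G) ∧
    -- `F` is the concave conjugate of `Ω`
    (∀ G : SymMat N, dualFn U G = concaveConj (freeEnergy U) G) ∧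
    -- the fiber over `G` is empty exactly when `G` is not positive semidefinite
    (∀ G : SymMat N, momentFiber G = ∅ ↔ G ∉ posSemidefCone N) ∧
    -- neither function takes the value `+∞`, and the domain of `F` is `S^N_{++}`
    (∀ A : SymMat N, freeEnergy U A ≠ ⊤) ∧
    (∀ G : SymMat N, dualFn U G ≠ ⊤) ∧
    effDom (dualFn U) = posDefCone N ∧
    -- smoothness and strict concavity
    ContDiffOn ℝ ∞ (fun A => (freeEnergy U A).toReal) (effDom (freeEnergy U)) ∧
    StrictConcaveOn ℝ (effDom (freeEnergy U)) (fun A => (freeEnergy U A).toReal) ∧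
    ContDiffOn ℝ ∞ (fun G => (dualFn U G).toReal) (posDefCone N) ∧
    StrictConcaveOn ℝ (posDefCone N) (fun G => (dualFn U G).toReal) ∧
    -- `∇Ω` is a bijection from `dom Ω` onto `S^N_{++}` with inverse `∇F`
    Set.BijOn (symGrad fun A => (freeEnergy U A).toReal)
      (effDom (freeEnergy U)) (posDefCone N) ∧
    Set.InvOn (symGrad fun G => (dualFn U G).toReal)
      (symGrad fun A => (freeEnergy U A).toReal)
      (effDom (freeEnergy U)) (posDefCone N) := by
  exact ⟨freeEnergy_eq_iInf hU, dualFn_eq_concaveConj hU, momentFiber_eq_empty_iff,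
    freeEnergy_ne_top hU.measurable, dualFn_ne_top hU, effDom_dualFn hU, contDiffOn_freeEnergy hU,
    strictConcaveOn_freeEnergy hU, contDiffOn_dualFn hU, strictConcaveOn_dualFn hU,
    bijOn_symGrad_freeEnergy hU, invOn_symGrad_dualFn hU⟩
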